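/- For bipartite pure states (unit vectors of $\mathbb C^A\otimes\mathbb C^B$ with finite-dimensional local spaces) write $\psi\to\varphi$ if some finite-round LOCC protocol transforms $\psi$ into $\varphi$ with certainty, and call $\psi,\varphi$ incomparable if neither $\psi\to\varphi$ nor $\varphi\to\psi$. Let $f(m)$ be the largest positive integer $n$ with $\psi^{\otimes m}\to\varphi^{\otimes n}$ ($f(m)=0$ if there is none), and let $$D(\psi,\varphi)=\sup_{m\ge 1}\frac{f(m)}{m},\qquad R(\psi,\varphi)=\inf_{\tau\in[0,\infty]}\frac{S^{(\tau)}(\psi)}{S^{(\tau)}(\varphi)},$$ where, if $\alpha_1\ge\alpha_2\ge\dots$ are the Schmidt coefficients of $\psi$ (the eigenvalues of its reduced density matrix), $S^{(\tau)}(\psi)=\frac1{1-\tau}\log_2\sum_i\alpha_i^\tau$ for $\tau\in(0,\infty)\setminus\{1\}$, $S^{(0)}(\psi)=\log_2\#\{i:\alpha_i\ne0\}$, $S^{(1)}(\psi)=-\sum_i\alpha_i\log_2\alpha_i$ (with $0\log_2 0=0$), and $S^{(\infty)}(\psi)=-\log_2\alpha_1$. Let $$\psi_1=\sqrt{0.40}\,|00\rangle+\sqrt{0.36}\,|11\rangle+\sqrt{0.14}\,|22\rangle+\sqrt{0.10}\,|33\rangle,\qquad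 \psi_2=\sqrt{0.50}\,|00\rangle+\sqrt{0.25}\,|11\rangle+\sqrt{0.25}\,|22\rangle,$$ $$\phi=\sqrt{0.60}\,|00\rangle+\sqrt{0.40}\,|11\rangle.$$ Then: 1. $\psi_1$ and $\psi_2$ are incomparable, while $\psi_1^{\otimes k}\to\psi_2^{\otimes k}$ for every $k\ge2$; 2. $\psi_1^{\otimes 8}\to\psi_2^{\otimes 9}$, and $D(\psi_1,\psi_2)\ge 9/8$; 3. $\psi_1^{\otimes 7}$ and $\psi_2^{\otimes 8}$ are incomparable, but $\psi_1^{\otimes7}\otimes\phi^{\otimes4}\to\psi_2^{\otimes8}\otimes\phi^{\otimes4}$, and $D(\psi_1,\psi_2)\ge 8/7$; in particular $D(\psi_1,\psi_2)>1$; 4. $R(\psi_1,\psi_2)\le S^{(2)}(\psi_1)/S^{(2)}(\psi_2)$, this quotient equals $1.1643$ after rounding to four decimals (that is, it differs from $1.1643$ by less than $0.00005$), $R(\psi_1,\psi_2)\le 1.1643<7/6$, and $\psi_1^{\otimes6}\not\to\psi_2^{\otimes7}$. -/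

import Mathlib

open scoped Kronecker ENNReal

/-- A bipartite pure state: a unit vector of `ℂ^A ⊗ ℂ^B`, given by its amplitudes in the product
basis `|a⟩|b⟩`. The first factor is held by Alice, the second one by Bob. -/
structure PureState (A B : Type) [Fintype A] [Fintype B] where
  amp : A × B → ℂ
  normalized : ∑ p, ‖amp p‖ ^ 2 = 1

namespace PureState

variable {A B C D : Type} [Fintype A] [Fintype B] [Fintype C] [Fintype D]

/-- The rank-one density matrix `|ψ⟩⟨ψ|`. -/
def density (ψ : PureState A B) : Matrix (A × B) (A × B) ℂ :=
  Matrix.vecMulVec ψ.amp (star ψ.amp)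

/-- `ψ ⊗ φ` as a bipartite state: Alice holds both first factors, Bob both second factors. -/
def tensor (ψ : PureState A B) (φ : PureState C D) : PureState (A × C) (B × D) where
  amp p := ψ.amp (p.1.1, p.2.1) * φ.amp (p.1.2, p.2.2)
  normalized := by
    rw [← (Equiv.prodProdProdComm A B C D).sum_comp]
    simp only [Equiv.prodProdProdComm_apply, norm_mul, mul_pow]
    rw [Fintype.sum_prod_type]
    simp only [← Finset.mul_sum, φ.normalized, mul_one, ψ.normalized]

/-- `ψ^{⊗ m}` as a bipartite state: Alice holds the `m` first factors, Bob the `m` second ones. -/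
def tpow (ψ : PureState A B) (m : ℕ) : PureState (Fin m → A) (Fin m → B) where
  amp p := ∏ i, ψ.amp (p.1 i, p.2 i)
  normalized := by
    classical
    rw [← (Equiv.arrowProdEquivProdArrow (Fin m) (fun _ => A) (fun _ => B)).sum_comp]
    simp only [Equiv.arrowProdEquivProdArrow, Equiv.coe_fn_mk, norm_prod, ← Finset.prod_pow]
    rw [← Fintype.prod_sum (fun (_ : Fin m) (p : A × B) => ‖ψ.amp p‖ ^ 2)]
    simp [ψ.normalized]

/-- The state `∑ i, √(α i) |i⟩|i⟩` for a probability vector `α`. -/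
noncomputable def ofSchmidt {ι : Type} [Fintype ι] [DecidableEq ι] (α : ι → ℝ)
    (h0 : ∀ i, 0 ≤ α i) (h1 : ∑ i, α i = 1) : PureState ι ι where
  amp p := if p.1 = p.2 then (Real.sqrt (α p.1) : ℂ) else 0
  normalized := by
    rw [Fintype.sum_prod_type, ← h1]
    refine Finset.sum_congr rfl fun i _ => ?_
    rw [Finset.sum_eq_single i]
    · simp [Real.sq_sqrt (h0 i)]
    · intro j _ hj
      simp [Ne.symm hj]
    · simp

end PureState

/-- Maps on density matrices of `A × B` realized by LOCC protocols with finitely many rounds whose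
final systems are `A' × B'`. Either the protocol ends, or one of the two parties performs a
measurement with finitely many outcomes (Kraus operators `K x` with `∑ x, (K x)ᴴ * K x = 1`, whose
output spaces may depend on the outcome, so local ancillas and discarding are covered), announces
the outcome `x`, and both parties go on with a protocol depending on `x`; summing over `x` forgets
the record at the end. -/
inductive IsLOCC (A' B' : Type) [Fintype A'] [DecidableEq A'] [Fintype B'] [DecidableEq B'] :
    ∀ (A B : Type) [Fintype A] [DecidableEq A] [Fintype B] [DecidableEq B],
      (Matrix (A × B) (A × B) ℂ → Matrix (A' × B') (A' × B') ℂ) → Prop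
  | finish : IsLOCC A' B' A' B' (fun ρ => ρ)
  | alice (A B : Type) [Fintype A] [DecidableEq A] [Fintype B] [DecidableEq B]
      (n : ℕ) (C : Fin n → Type) [∀ x, Fintype (C x)] [∀ x, DecidableEq (C x)]
      (K : ∀ x, Matrix (C x) A ℂ) (hK : ∑ x, (K x).conjTranspose * K x = 1)
      (E : ∀ x, Matrix (C x × B) (C x × B) ℂ → Matrix (A' × B') (A' × B') ℂ)
      (hE : ∀ x, IsLOCC A' B' (C x) B (E x)) :
      IsLOCC A' B' A B (fun ρ => ∑ x,
        E x ((K x ⊗ₖ (1 : Matrix B B ℂ)) * ρ * (K x ⊗ₖ (1 : Matrix B B ℂ)).conjTranspose))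
  | bob (A B : Type) [Fintype A] [DecidableEq A] [Fintype B] [DecidableEq B]
      (n : ℕ) (C : Fin n → Type) [∀ x, Fintype (C x)] [∀ x, DecidableEq (C x)]
      (K : ∀ x, Matrix (C x) B ℂ) (hK : ∑ x, (K x).conjTranspose * K x = 1)
      (E : ∀ x, Matrix (A × C x) (A × C x) ℂ → Matrix (A' × B') (A' × B') ℂ)
      (hE : ∀ x, IsLOCC A' B' A (C x) (E x)) :
      IsLOCC A' B' A B (fun ρ => ∑ x,
        E x (((1 : Matrix A A ℂ) ⊗ₖ K x) * ρ * ((1 : Matrix A A ℂ) ⊗ₖ K x).conjTranspose))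

namespace PureState

variable {A B C D : Type} [Fintype A] [DecidableEq A] [Fintype B] [DecidableEq B]
  [Fintype C] [DecidableEq C] [Fintype D] [DecidableEq D]

/-- `ψ → φ`: some LOCC protocol transforms `ψ` into `φ` with certainty. -/
def ConvertsTo (ψ : PureState A B) (φ : PureState C D) : Prop :=
  ∃ Λ, IsLOCC C D A B Λ ∧ Λ ψ.density = φ.density

/-- Neither state can be transformed into the other one by LOCC with certainty. -/
def Incomparable (ψ : PureState A B) (φ : PureState C D) : Prop :=
  ¬ ψ.ConvertsTo φ ∧ ¬ φ.ConvertsTo ψ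

/-- `f(m)`: the largest positive `n` with `ψ^{⊗ m} → φ^{⊗ n}`, and `0` if there is none. -/
noncomputable def maxCopies (ψ : PureState A B) (φ : PureState C D) (m : ℕ) : ℕ :=
  sSup {n : ℕ | 0 < n ∧ (ψ.tpow m).ConvertsTo (φ.tpow n)}

/-- The deterministic entanglement exchange rate `D(ψ, φ) = sup_{m ≥ 1} f(m) / m`. -/
noncomputable def exchangeRate (ψ : PureState A B) (φ : PureState C D) : ℝ :=
  ⨆ m : ℕ+, (ψ.maxCopies φ m : ℝ) / (m : ℝ)

/-- The amplitudes of `ψ` as a matrix. -/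
def ampMatrix (ψ : PureState A B) : Matrix A B ℂ := Matrix.of fun a b => ψ.amp (a, b)

/-- The Schmidt coefficients (squares of the coefficients in a Schmidt decomposition): the
eigenvalues, with multiplicity, of Alice's reduced density matrix. -/
noncomputable def schmidtCoeff (ψ : PureState A B) : A → ℝ :=
  (Matrix.isHermitian_mul_conjTranspose_self ψ.ampMatrix).eigenvalues

/-- The Rényi entropy of order `τ ∈ [0, ∞]`. -/
noncomputable def renyiEntropy (τ : ℝ≥0∞) (ψ : PureState A B) : ℝ :=
  if τ = 0 then Real.logb 2 (Nat.card {i // ψ.schmidtCoeff i ≠ 0})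
  else if τ = 1 then - ∑ i, ψ.schmidtCoeff i * Real.logb 2 (ψ.schmidtCoeff i)
  else if τ = ⊤ then - Real.logb 2 (⨆ i, ψ.schmidtCoeff i)
  else 1 / (1 - τ.toReal) * Real.logb 2 (∑ i, ψ.schmidtCoeff i ^ τ.toReal)

/-- The entropy ratio `R(ψ, φ) = inf_τ S^{(τ)}(ψ) / S^{(τ)}(φ)`. -/
noncomputable def entropyRatio (ψ : PureState A B) (φ : PureState C D) : ℝ :=
  ⨅ τ : ℝ≥0∞, renyiEntropy τ ψ / renyiEntropy τ φ

/-- `√0.40 |00⟩ + √0.36 |11⟩ + √0.14 |22⟩ + √0.10 |33⟩`. -/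
noncomputable def sourceState : PureState (Fin 4) (Fin 4) :=
  ofSchmidt ![0.40, 0.36, 0.14, 0.10]
    (by intro i; fin_cases i <;> norm_num) (by norm_num [Fin.sum_univ_succ])

/-- `√0.50 |00⟩ + √0.25 |11⟩ + √0.25 |22⟩`. -/
noncomputable def targetState : PureState (Fin 3) (Fin 3) :=
  ofSchmidt ![0.50, 0.25, 0.25]
    (by intro i; fin_cases i <;> norm_num) (by norm_num [Fin.sum_univ_succ])

/-- `√0.60 |00⟩ + √0.40 |11⟩`. -/
noncomputable def catalystState : PureState (Fin 2) (Fin 2) :=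
  ofSchmidt ![0.60, 0.40]
    (by intro i; fin_cases i <;> norm_num) (by norm_num [Fin.sum_univ_succ])

end PureState

/-!
The proof rests on Nielsen's theorem for states in Schmidt form: `ψ → φ` if and only if the Schmidt
coefficients of `φ` majorize those of `ψ` (for the converse, all coefficients of `ψ` are nonzero and
there are at least as many as for `φ`, which holds throughout). Majorization is used in the form
`∑ (a i - t)⁺ ≤ ∑ (b j - t)⁺` for all `t ≥ 0` (`Majorizes`), which is visibly stable under tensor
products.

*Necessity* (`PureState.ConvertsTo.majorizes`). The squared Hilbert–Schmidt distance of the amplitude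
matrix to the matrices of rank at most `k` does not increase: a protocol acts on amplitude matrices
by left and right multiplications, which do not raise the rank, and by `∑ (K x)ᴴ * K x = 1` it
preserves the total squared distance between the branches started from two matrices
(`IsLOCC.exists_branches`). Every branch of a deterministic conversion is a multiple of the target
(`exists_smul_of_sum_pureOp_eq`). For a diagonal matrix the distance to rank `k` is bounded below as
in the Eckart–Young theorem (`le_frobSq_diagonal_sub`).

*Sufficiency* (`PureState.convertsTo_of_majorizes`). By a separating hyperplane and the rearrangement
inequality, the source coefficients are a mixture of embeddings of the target coefficients
(`Majorizes.exists_mixture`). The mixture is turned into one measurement by Alice followed by a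
correction by Bob.

For copies of the concrete states majorization is a finite computation: it has to be tested only at
the coefficients of the target (`majorizes_of_forall_entry`), which take few values, and the
coefficients of the source are grouped by type (`sum_quaternary`). Two and three copies generate all
larger numbers of copies. The rate `8 / 7` is approached by buying the catalyst with four copies of
the source and reusing it (`majorizes_copies_via_catalyst`). Comparing largest coefficients shows
that at most `2 * m` copies can be produced from `m`, so the suprema in the definition of the rate
are genuine. The entropy ratio of order `2` is `log 0.3192 / log 0.375`, enclosed between the
fractions `241 / 207` and `163 / 140`.
-/

open Matrix

/-! ### Branches of an LOCC protocol -/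

section PureOperators

variable {A B C : Type}

/-- The rank-one operator `|M⟩⟨M|` on `ℂ^A ⊗ ℂ^B` of the (not necessarily normalized) vector whose
amplitude matrix is `M`. -/
def pureOp (M : Matrix A B ℂ) : Matrix (A × B) (A × B) ℂ :=
  vecMulVec (fun p => M p.1 p.2) (star fun p => M p.1 p.2)

lemma pureOp_apply (M : Matrix A B ℂ) (p q : A × B) :
    pureOp M p q = M p.1 p.2 * star (M q.1 q.2) := rfl

variable [Fintype A] [Fintype B]

lemma PureState.density_eq_pureOp (ψ : PureState A B) : ψ.density = pureOp ψ.ampMatrix := rfl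

lemma kronecker_one_conj_pureOp [DecidableEq B] (K : Matrix C A ℂ) (M : Matrix A B ℂ) :
    (K ⊗ₖ (1 : Matrix B B ℂ)) * pureOp M * (K ⊗ₖ (1 : Matrix B B ℂ)).conjTranspose =
      pureOp (K * M) := by
  rw [pureOp, mul_vecMulVec, vecMulVec_mul, ← star_mulVec, pureOp]
  have : ((K ⊗ₖ (1 : Matrix B B ℂ)) *ᵥ fun p : A × B => M p.1 p.2) =
      fun p => (K * M) p.1 p.2 := by
    funext p
    simp [mulVec, dotProduct, Fintype.sum_prod_type, kroneckerMap_apply, one_apply, mul_apply]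
  rw [this]

lemma one_kronecker_conj_pureOp [DecidableEq A] (K : Matrix C B ℂ) (M : Matrix A B ℂ) :
    ((1 : Matrix A A ℂ) ⊗ₖ K) * pureOp M * ((1 : Matrix A A ℂ) ⊗ₖ K).conjTranspose =
      pureOp (M * Kᵀ) := by
  rw [pureOp, mul_vecMulVec, vecMulVec_mul, ← star_mulVec, pureOp]
  have : (((1 : Matrix A A ℂ) ⊗ₖ K) *ᵥ fun p : A × B => M p.1 p.2) =
      fun p => (M * Kᵀ) p.1 p.2 := by
    funext p
    simp [mulVec, dotProduct, Fintype.sum_prod_type, kroneckerMap_apply, one_apply, mul_apply,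
      mul_comm]
  rw [this]

/-- The squared Hilbert–Schmidt norm of a matrix. -/
noncomputable def frobSq (M : Matrix A B ℂ) : ℝ := ∑ i, ∑ j, ‖M i j‖ ^ 2

lemma frobSq_nonneg (M : Matrix A B ℂ) : 0 ≤ frobSq M :=
  Finset.sum_nonneg fun _ _ => Finset.sum_nonneg fun _ _ => sq_nonneg _

lemma frobSq_transpose (M : Matrix A B ℂ) : frobSq Mᵀ = frobSq M :=
  Finset.sum_comm

lemma frobSq_eq_trace (M : Matrix A B ℂ) : (frobSq M : ℂ) = (Mᴴ * M).trace := by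
  rw [← frobSq_transpose]
  simp [frobSq, trace, mul_apply, Complex.conj_mul']

lemma frobSq_smul (c : ℂ) (M : Matrix A B ℂ) : frobSq (c • M) = ‖c‖ ^ 2 * frobSq M := by
  simp [frobSq, mul_pow, Finset.mul_sum]

lemma sum_frobSq_kraus_mul [DecidableEq A] {n : ℕ} {C : Fin n → Type} [∀ x, Fintype (C x)]
    (K : ∀ x, Matrix (C x) A ℂ) (hK : ∑ x, (K x).conjTranspose * K x = 1) (M : Matrix A B ℂ) :
    ∑ x, frobSq (K x * M) = frobSq M := by
  have h : ((∑ x, frobSq (K x * M) : ℝ) : ℂ) = (frobSq M : ℂ) := by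
    push_cast
    simp only [frobSq_eq_trace, ← trace_sum]
    congr 1
    calc ∑ x, (K x * M)ᴴ * (K x * M) = Mᴴ * (∑ x, (K x)ᴴ * K x) * M := by
          simp [Matrix.mul_sum, Matrix.sum_mul, Matrix.mul_assoc]
      _ = Mᴴ * M := by rw [hK, Matrix.mul_one]
  exact_mod_cast h

lemma sum_frobSq_mul_kraus [DecidableEq B] {n : ℕ} {C : Fin n → Type} [∀ x, Fintype (C x)]
    (K : ∀ x, Matrix (C x) B ℂ) (hK : ∑ x, (K x).conjTranspose * K x = 1) (M : Matrix A B ℂ) :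
    ∑ x, frobSq (M * (K x)ᵀ) = frobSq M := by
  rw [← frobSq_transpose M, ← sum_frobSq_kraus_mul K hK]
  refine Finset.sum_congr rfl fun x _ => ?_
  rw [← frobSq_transpose, transpose_mul, transpose_transpose]

end PureOperators

/-- Along an LOCC protocol the operator `|M⟩⟨M|` turns into a sum of rank-one operators `|V l⟩⟨V l|`,
one for each record `l` of measurement outcomes. Running the protocol on a second matrix `N` gives
matrices `W l` whose rank is at most that of `N`, and the total squared distance is conserved. -/
lemma IsLOCC.exists_branches {C D A B : Type} [Fintype C] [DecidableEq C] [Fintype D]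
    [DecidableEq D] [Fintype A] [DecidableEq A] [Fintype B] [DecidableEq B]
    {Λ : Matrix (A × B) (A × B) ℂ → Matrix (C × D) (C × D) ℂ} (h : IsLOCC C D A B Λ)
    (M N : Matrix A B ℂ) :
    ∃ (L : Type) (_ : Fintype L) (V W : L → Matrix C D ℂ),
      Λ (pureOp M) = ∑ l, pureOp (V l) ∧ ∑ l, frobSq (V l - W l) = frobSq (M - N) ∧
        ∀ l, (W l).rank ≤ N.rank := by
  induction h with
  | finish => exact ⟨Unit, inferInstance, fun _ => M, fun _ => N, by simp, by simp, by simp⟩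
  | alice A B n C' K hK E hE ih =>
    choose L hL V W h1 h2 h3 using fun x => ih x (K x * M) (K x * N)
    refine ⟨Σ x, L x, inferInstance, fun l => V l.1 l.2, fun l => W l.1 l.2, ?_, ?_, ?_⟩
    · rw [Fintype.sum_sigma]
      refine Finset.sum_congr rfl fun x _ => ?_
      rw [kronecker_one_conj_pureOp, h1]
    · rw [Fintype.sum_sigma, ← sum_frobSq_kraus_mul K hK (M - N)]
      refine Finset.sum_congr rfl fun x _ => ?_
      rw [h2, Matrix.mul_sub]
    · exact fun l => (h3 l.1 l.2).trans (rank_mul_le_right _ _)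
  | bob A B n C' K hK E hE ih =>
    choose L hL V W h1 h2 h3 using fun x => ih x (M * (K x)ᵀ) (N * (K x)ᵀ)
    refine ⟨Σ x, L x, inferInstance, fun l => V l.1 l.2, fun l => W l.1 l.2, ?_, ?_, ?_⟩
    · rw [Fintype.sum_sigma]
      refine Finset.sum_congr rfl fun x _ => ?_
      rw [one_kronecker_conj_pureOp, h1]
    · rw [Fintype.sum_sigma, ← sum_frobSq_mul_kraus K hK (M - N)]
      refine Finset.sum_congr rfl fun x _ => ?_
      rw [h2, Matrix.sub_mul]
    · exact fun l => (h3 l.1 l.2).trans (rank_mul_le_left _ _)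

/-- If rank-one operators add up to the rank-one operator of a unit vector `u`, then each of the
vectors is a multiple of `u`: the squared norms of their components orthogonal to `u` add up
to zero. -/
lemma exists_smul_of_sum_pureOp_eq {A B L : Type} [Fintype A] [Fintype B] [Fintype L]
    (U : Matrix A B ℂ) (hU : frobSq U = 1) (V : L → Matrix A B ℂ)
    (h : ∑ l, pureOp (V l) = pureOp U) :
    ∃ c : L → ℂ, (∀ l, V l = c l • U) ∧ ∑ l, ‖c l‖ ^ 2 = 1 := by
  set u : A × B → ℂ := fun p => U p.1 p.2
  set v : L → A × B → ℂ := fun l p => V l p.1 p.2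
  have hu : ∑ p, u p * star (u p) = 1 := by
    have : ∑ p, u p * star (u p) = ((frobSq U : ℝ) : ℂ) := by
      simp [u, frobSq, Fintype.sum_prod_type, Complex.mul_conj']
    rw [this, hU]; simp
  have hv : ∀ p q, ∑ l, v l p * star (v l q) = u p * star (u q) := by
    intro p q
    have := congrFun (congrFun h p) q
    simpa [Matrix.sum_apply, pureOp_apply] using this
  set c : L → ℂ := fun l => ∑ p, star (u p) * v l p
  have hc : ∑ l, c l * star (c l) = 1 := by
    calc ∑ l, c l * star (c l)
        = ∑ l, ∑ p, ∑ q, star (u p) * u q * (v l p * star (v l q)) := by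
          refine Finset.sum_congr rfl fun l _ => ?_
          simp only [c, star_sum, Finset.sum_mul_sum, star_mul', star_star]
          refine Finset.sum_congr rfl fun p _ => Finset.sum_congr rfl fun q _ => by ring
      _ = ∑ p, ∑ q, star (u p) * u q * (u p * star (u q)) := by
          rw [Finset.sum_comm]
          refine Finset.sum_congr rfl fun p _ => ?_
          rw [Finset.sum_comm]
          refine Finset.sum_congr rfl fun q _ => ?_
          rw [← Finset.mul_sum, hv]
      _ = (∑ p, u p * star (u p)) * ∑ q, u q * star (u q) := by
          rw [Finset.sum_mul_sum]
          refine Finset.sum_congr rfl fun p _ => Finset.sum_congr rfl fun q _ => by ring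
      _ = 1 := by rw [hu, one_mul]
  have hperp : ∀ l, ∑ p, (v l p - c l * u p) * star (v l p - c l * u p) =
      ∑ p, v l p * star (v l p) - c l * star (c l) := by
    intro l
    have h1 : ∑ p, v l p * star (u p) = c l := by
      simp only [c]
      exact Finset.sum_congr rfl fun p _ => mul_comm _ _
    have h2 : ∑ p, u p * star (v l p) = star (c l) := by
      simp only [c, star_sum, star_mul', star_star]
    calc ∑ p, (v l p - c l * u p) * star (v l p - c l * u p)
        = ∑ p, v l p * star (v l p) - star (c l) * ∑ p, v l p * star (u p)
          - c l * ∑ p, u p * star (v l p) + c l * star (c l) * ∑ p, u p * star (u p) := by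
          simp only [Finset.mul_sum, ← Finset.sum_sub_distrib, ← Finset.sum_add_distrib]
          refine Finset.sum_congr rfl fun p _ => ?_
          rw [star_sub, star_mul']
          ring
      _ = _ := by rw [h1, h2, hu]; ring
  have hnorm : ∀ z : ℂ, z * star z = ((‖z‖ ^ 2 : ℝ) : ℂ) := fun z => by
    simpa using Complex.mul_conj' z
  have hzero : ∑ l, ∑ p, ‖v l p - c l * u p‖ ^ 2 = 0 := by
    have : ((∑ l, ∑ p, ‖v l p - c l * u p‖ ^ 2 : ℝ) : ℂ) = 0 := by
      simp only [Complex.ofReal_sum, ← hnorm, hperp, Finset.sum_sub_distrib, hc]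
      rw [Finset.sum_comm]
      simp only [hv, hu, sub_self]
    exact_mod_cast this
  refine ⟨c, fun l => ?_, ?_⟩
  · ext i j
    rw [Finset.sum_eq_zero_iff_of_nonneg fun l _ => by positivity] at hzero
    have h1 := hzero l (Finset.mem_univ l)
    rw [Finset.sum_eq_zero_iff_of_nonneg fun p _ => by positivity] at h1
    have h2 := h1 (i, j) (Finset.mem_univ _)
    simpa [u, v, sub_eq_zero] using h2
  · have : ((∑ l, ‖c l‖ ^ 2 : ℝ) : ℂ) = 1 := by
      simp only [Complex.ofReal_sum, ← hnorm, hc]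
    exact_mod_cast this

namespace PureState

variable {A B C D : Type} [Fintype A] [DecidableEq A] [Fintype B] [DecidableEq B]
  [Fintype C] [DecidableEq C] [Fintype D] [DecidableEq D]

lemma frobSq_ampMatrix {A B : Type} [Fintype A] [Fintype B] (ψ : PureState A B) :
    frobSq ψ.ampMatrix = 1 := by
  rw [← ψ.normalized, Fintype.sum_prod_type]
  rfl

/-- The squared distance to the matrices of rank at most `k` does not increase under a deterministic
LOCC transformation. -/
lemma ConvertsTo.le_frobSq_sub {ψ : PureState A B} {φ : PureState C D} (h : ψ.ConvertsTo φ)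
    {k : ℕ} {d : ℝ} (hd : ∀ N : Matrix C D ℂ, N.rank ≤ k → d ≤ frobSq (φ.ampMatrix - N))
    (N : Matrix A B ℂ) (hN : N.rank ≤ k) : d ≤ frobSq (ψ.ampMatrix - N) := by
  obtain ⟨Λ, hΛ, hφ⟩ := h
  obtain ⟨L, hL, V, W, h1, h2, h3⟩ := hΛ.exists_branches ψ.ampMatrix N
  rw [density_eq_pureOp, density_eq_pureOp, h1] at hφ
  obtain ⟨c, hc, hc1⟩ := exists_smul_of_sum_pureOp_eq _ φ.frobSq_ampMatrix V hφ
  rw [← h2, ← one_mul d, ← hc1, Finset.sum_mul]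
  refine Finset.sum_le_sum fun l _ => ?_
  rcases eq_or_ne (c l) 0 with h0 | h0
  · simp only [h0, norm_zero]
    simpa using frobSq_nonneg _
  · have : V l - W l = c l • (φ.ampMatrix - (c l)⁻¹ • W l) := by
      rw [hc l, smul_sub, smul_smul, mul_inv_cancel₀ h0, one_smul]
    rw [this, frobSq_smul]
    refine mul_le_mul_of_nonneg_left (hd _ ?_) (by positivity)
    have : (c l)⁻¹ • W l = ((c l)⁻¹ • (1 : Matrix C C ℂ)) * W l := by simp
    rw [this]
    exact (rank_mul_le_right _ _).trans ((h3 l).trans hN)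

end PureState

/-! ### Majorization is necessary -/

/-- `b` majorizes `a`, for families with equal sums, in the Hardy–Littlewood–Pólya form
`∑ (a i - t)⁺ ≤ ∑ (b j - t)⁺`. With `t` restricted to `t ≥ 0` the condition is insensitive to
appending zeros, so that the index types need not have the same size. -/
def Majorizes {ι κ : Type} [Fintype ι] [Fintype κ] (b : κ → ℝ) (a : ι → ℝ) : Prop :=
  ∀ t : ℝ, 0 ≤ t → ∑ i, max (a i - t) 0 ≤ ∑ j, max (b j - t) 0

section LowRank

variable {ι κ : Type} [Fintype ι] [Fintype κ] [DecidableEq ι] [DecidableEq κ]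

lemma rank_toEuclideanLin_range (N : Matrix κ κ ℂ) :
    Module.finrank ℂ (LinearMap.range (Matrix.toEuclideanLin N)) = N.rank := by
  rw [Matrix.rank_eq_finrank_range_toLin N (EuclideanSpace.basisFun κ ℂ).toBasis
    (EuclideanSpace.basisFun κ ℂ).toBasis, Matrix.toEuclideanLin_eq_toLin_orthonormal]

/-- The diagonal entries of an orthogonal projection add up to its rank. -/
lemma sum_norm_sq_starProjection (U : Submodule ℂ (EuclideanSpace ℂ κ)) :
    ∑ j, ‖U.starProjection (EuclideanSpace.single j (1 : ℂ))‖ ^ 2 = Module.finrank ℂ U := by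
  let b := stdOrthonormalBasis ℂ U
  have h1 : ∀ j, ‖U.starProjection (EuclideanSpace.single j (1 : ℂ))‖ ^ 2 =
      ∑ r, ‖(b r : EuclideanSpace ℂ κ) j‖ ^ 2 := by
    intro j
    rw [U.starProjection_apply, Submodule.norm_coe, ← b.sum_sq_norm_inner_right]
    refine Finset.sum_congr rfl fun r _ => ?_
    rw [Submodule.coe_inner, ← Submodule.starProjection_apply,
      ← Submodule.inner_starProjection_left_eq_right, Submodule.starProjection_eq_self_iff.2 (b r).2,
      ← inner_conj_symm, RCLike.norm_conj, EuclideanSpace.inner_single_left]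
    simp
  simp only [h1]
  rw [Finset.sum_comm]
  have h2 : ∀ r, ∑ j, ‖(b r : EuclideanSpace ℂ κ) j‖ ^ 2 = 1 := by
    intro r
    rw [← EuclideanSpace.norm_sq_eq, Submodule.norm_coe, b.norm_eq_one]
    simp
  simp [h2]

lemma frobSq_diagonal (v : κ → ℂ) : frobSq (diagonal v) = ∑ j, ‖v j‖ ^ 2 := by
  refine Finset.sum_congr rfl fun i _ => ?_
  rw [Finset.sum_eq_single i]
  · simp
  · intro j _ hj
    simp [diagonal_apply_ne _ hj.symm]
  · simp

/-- The lower bound in the Eckart–Young theorem, for a diagonal matrix. -/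
lemma le_frobSq_diagonal_sub {β : κ → ℝ} (h0 : ∀ j, 0 ≤ β j) (N : Matrix κ κ ℂ) (t : ℝ) :
    ∑ j, β j - t * N.rank - ∑ j, max (β j - t) 0 ≤
      frobSq (diagonal (fun j => (Real.sqrt (β j) : ℂ)) - N) := by
  set U := LinearMap.range (Matrix.toEuclideanLin N)
  set e : κ → EuclideanSpace ℂ κ := fun j => EuclideanSpace.single j 1
  set q : κ → ℝ := fun j => ‖U.starProjection (e j)‖ ^ 2
  have hq1 : ∀ j, q j ≤ 1 := by
    intro j
    have := U.norm_starProjection_apply_le (e j)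
    simp only [e, PiLp.norm_single, norm_one] at this
    exact pow_le_one₀ (norm_nonneg _) this
  have hq0 : ∀ j, 0 ≤ q j := fun j => by positivity
  have hq : ∑ j, q j = N.rank := by
    rw [← rank_toEuclideanLin_range N, ← sum_norm_sq_starProjection]
  have hcol : ∀ j, β j * (1 - q j) ≤
      ∑ i, ‖(diagonal (fun j => (Real.sqrt (β j) : ℂ)) - N) i j‖ ^ 2 := by
    intro j
    set z : EuclideanSpace ℂ κ := (Real.sqrt (β j) : ℂ) • e j - Matrix.toEuclideanLin N (e j)
    have hz : ∑ i, ‖(diagonal (fun j => (Real.sqrt (β j) : ℂ)) - N) i j‖ ^ 2 = ‖z‖ ^ 2 := by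
      rw [EuclideanSpace.norm_sq_eq]
      refine Finset.sum_congr rfl fun i _ => ?_
      simp only [z, e]
      congr 2
      by_cases hij : i = j
      · subst hij
        simp [Matrix.toLpLin_apply]
      · simp [Matrix.toLpLin_apply, hij]
    have hperp : Uᗮ.starProjection z =
        (Real.sqrt (β j) : ℂ) • Uᗮ.starProjection (e j) := by
      have : Uᗮ.starProjection (Matrix.toEuclideanLin N (e j)) = 0 := by
        rw [Submodule.starProjection_apply_eq_zero_iff]
        exact Submodule.le_orthogonal_orthogonal _ (LinearMap.mem_range_self _ _)
      simp [z, map_sub, this]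
    have hnorm := Submodule.norm_sq_eq_add_norm_sq_starProjection (e j) U
    have he : ‖e j‖ ^ 2 = 1 := by simp [e]
    calc β j * (1 - q j) = ‖Uᗮ.starProjection z‖ ^ 2 := by
          rw [hperp, norm_smul, mul_pow]
          simp only [Complex.norm_real, Real.norm_eq_abs, sq_abs, Real.sq_sqrt (h0 j)]
          congr 1
          simp only [q]
          linarith
      _ ≤ ‖z‖ ^ 2 := by
          gcongr
          exact Uᗮ.norm_starProjection_apply_le z
      _ = _ := hz.symm
  calc ∑ j, β j - t * N.rank - ∑ j, max (β j - t) 0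
      = ∑ j, (β j - t * q j - max (β j - t) 0) := by
        rw [← hq, Finset.sum_sub_distrib, Finset.sum_sub_distrib, Finset.mul_sum]
    _ ≤ ∑ j, β j * (1 - q j) := by
        refine Finset.sum_le_sum fun j _ => ?_
        have h1 : (β j - t) * q j ≤ max (β j - t) 0 * q j :=
          mul_le_mul_of_nonneg_right (le_max_left _ _) (hq0 j)
        have h2 : max (β j - t) 0 * q j ≤ max (β j - t) 0 :=
          mul_le_of_le_one_right (le_max_right _ _) (hq1 j)
        nlinarith
    _ ≤ _ := by
        rw [frobSq, Finset.sum_comm]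
        exact Finset.sum_le_sum fun j _ => hcol j

namespace PureState

lemma ampMatrix_ofSchmidt (α : ι → ℝ) (h0 : ∀ i, 0 ≤ α i) (h1 : ∑ i, α i = 1) :
    (ofSchmidt α h0 h1).ampMatrix = diagonal fun i => (Real.sqrt (α i) : ℂ) := by
  ext i j
  simp [ampMatrix, ofSchmidt, diagonal_apply]

/-- The necessity half of Nielsen's theorem: a deterministic LOCC transformation can only replace
the Schmidt coefficients by ones that majorize them. -/
theorem ConvertsTo.majorizes {α : ι → ℝ} {h0 : ∀ i, 0 ≤ α i} {h1 : ∑ i, α i = 1}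
    {β : κ → ℝ} {k0 : ∀ j, 0 ≤ β j} {k1 : ∑ j, β j = 1}
    (h : (ofSchmidt α h0 h1).ConvertsTo (ofSchmidt β k0 k1)) : Majorizes β α := by
  intro t ht
  -- Keeping only the coefficients above `t` is the best approximation of its rank.
  set S : Finset ι := Finset.univ.filter fun i => t < α i
  set N : Matrix ι ι ℂ := diagonal fun i => if i ∈ S then (Real.sqrt (α i) : ℂ) else 0
  have hrank : N.rank ≤ S.card := by
    rw [rank_diagonal]
    rw [Fintype.card_subtype]
    refine Finset.card_le_card fun i hi => ?_
    by_contra h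
    simp [h] at hi
  have key := h.le_frobSq_sub (k := S.card)
    (d := 1 - t * S.card - ∑ j, max (β j - t) 0) (fun N' hN' => by
      have := le_frobSq_diagonal_sub k0 N' t
      rw [k1] at this
      rw [ampMatrix_ofSchmidt]
      have h2 : t * (N'.rank : ℝ) ≤ t * S.card := by gcongr
      linarith) N hrank
  have hN : frobSq ((ofSchmidt α h0 h1).ampMatrix - N) = 1 - ∑ i ∈ S, α i := by
    rw [ampMatrix_ofSchmidt, diagonal_sub, frobSq_diagonal, ← h1, Finset.sum_filter,
      ← Finset.sum_sub_distrib]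
    refine Finset.sum_congr rfl fun i _ => ?_
    by_cases hi : t < α i <;> simp [S, hi, Real.sq_sqrt (h0 i)]
  have hS : ∑ i, max (α i - t) 0 = ∑ i ∈ S, α i - t * S.card := by
    rw [mul_comm, ← nsmul_eq_mul, ← Finset.sum_const, ← Finset.sum_sub_distrib, Finset.sum_filter]
    refine Finset.sum_congr rfl fun i _ => ?_
    split_ifs with hi
    · exact max_eq_left (by linarith)
    · exact max_eq_right (by linarith)
  rw [hS]
  linarith

end PureState

end LowRank

/-! ### Majorized families are mixtures of rearrangements -/

section Mixture

/-- A summation by parts: if the partial sums of `d` are nonnegative and the total sum vanishes,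
then `d` has a nonnegative inner product with every nonincreasing weight. -/
lemma sum_range_mul_nonneg_of_antitone {N : ℕ} {w d : ℕ → ℝ}
    (hw : ∀ k, k + 1 < N → w (k + 1) ≤ w k)
    (hd : ∀ n ≤ N, 0 ≤ ∑ k ∈ Finset.range n, d k) (h0 : ∑ k ∈ Finset.range N, d k = 0) :
    0 ≤ ∑ k ∈ Finset.range N, w k * d k := by
  have key : ∀ n, n + 1 ≤ N →
      w n * ∑ k ∈ Finset.range (n + 1), d k ≤ ∑ k ∈ Finset.range (n + 1), w k * d k := by
    intro n
    induction n with
    | zero => simp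
    | succ n ih =>
      intro hn
      have h1 := ih (by omega)
      have h2 := mul_le_mul_of_nonneg_right (hw n (by omega)) (hd (n + 1) (by omega))
      rw [Finset.sum_range_succ, Finset.sum_range_succ _ (n + 1), mul_add]
      linarith
  rcases N with _ | n
  · simp
  · have := key n le_rfl
    rwa [h0, mul_zero] at this

/-- The rearrangement of `b` sorted in the same order as the weight `w` beats every family that `b`
majorizes. -/
lemma Majorizes.exists_perm_sum_le {ι : Type} [Fintype ι] {a b : ι → ℝ} (h : Majorizes b a)
    (hb : ∀ i, 0 ≤ b i) (hsum : ∑ i, a i = ∑ i, b i) (w : ι → ℝ) :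
    ∃ σ : Equiv.Perm ι, ∑ i, w i * a i ≤ ∑ i, w i * b (σ i) := by
  classical
  obtain ⟨N, hN⟩ : ∃ N, Fintype.card ι = N := ⟨_, rfl⟩
  let e0 : Fin N ≃ ι := (Fintype.equivFinOfCardEq hN).symm
  -- `e` lists `ι` by decreasing `w`, and `f` lists it by decreasing `b`.
  let e : Fin N ≃ ι := (Tuple.sort fun k => - w (e0 k)).trans e0
  let f : Fin N ≃ ι := (Tuple.sort fun k => - b (e0 k)).trans e0
  have hwanti : ∀ {k l : Fin N}, k ≤ l → w (e l) ≤ w (e k) := fun {k l} hkl => by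
    have := Tuple.monotone_sort (fun k => - w (e0 k)) hkl
    simpa [e] using this
  have hbanti : ∀ {k l : Fin N}, k ≤ l → b (f l) ≤ b (f k) := fun {k l} hkl => by
    have := Tuple.monotone_sort (fun k => - b (e0 k)) hkl
    simpa [f] using this
  refine ⟨e.symm.trans f, ?_⟩
  rw [← sub_nonneg, ← Finset.sum_sub_distrib, ← e.sum_comp]
  simp only [Equiv.trans_apply, Equiv.symm_apply_apply, ← mul_sub]
  let W : ℕ → ℝ := fun k => if hk : k < N then w (e ⟨k, hk⟩) else 0
  let A : ℕ → ℝ := fun k => if hk : k < N then a (e ⟨k, hk⟩) else 0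
  let B : ℕ → ℝ := fun k => if hk : k < N then b (f ⟨k, hk⟩) else 0
  have hgoal : ∑ k : Fin N, w (e k) * (b (f k) - a (e k)) =
      ∑ k ∈ Finset.range N, W k * (B k - A k) := by
    rw [← Fin.sum_univ_eq_sum_range (fun k => W k * (B k - A k))]
    simp [W, A, B]
  rw [hgoal]
  refine sum_range_mul_nonneg_of_antitone ?_ ?_ ?_
  · intro k hk
    simp only [W, hk, (Nat.lt_succ_self k).trans hk, dif_pos]
    exact hwanti (Fin.mk_le_mk.2 (Nat.le_succ k))
  · intro n hn
    rcases n with _ | n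
    · simp
    -- The threshold is the smallest of the `n + 1` largest entries of `b`.
    set t := b (f ⟨n, hn⟩)
    have h1 : ∑ k ∈ Finset.range (n + 1), (A k - t) ≤ ∑ i, max (a i - t) 0 := by
      rw [← e.sum_comp]
      calc ∑ k ∈ Finset.range (n + 1), (A k - t)
          ≤ ∑ k ∈ Finset.range (n + 1), max (A k - t) 0 :=
            Finset.sum_le_sum fun k _ => le_max_left _ _
        _ ≤ ∑ k ∈ Finset.range N, max (A k - t) 0 :=
            Finset.sum_le_sum_of_subset_of_nonneg (Finset.range_mono hn)
              fun k _ _ => le_max_right _ _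
        _ = ∑ k : Fin N, max (a (e k) - t) 0 := by
            rw [← Fin.sum_univ_eq_sum_range (fun k => max (A k - t) 0)]
            simp [A]
    have h2 : ∑ i, max (b i - t) 0 = ∑ k ∈ Finset.range (n + 1), (B k - t) := by
      rw [← f.sum_comp]
      calc ∑ k : Fin N, max (b (f k) - t) 0 = ∑ k ∈ Finset.range N, max (B k - t) 0 := by
            rw [← Fin.sum_univ_eq_sum_range (fun k => max (B k - t) 0)]
            simp [B]
        _ = ∑ k ∈ Finset.range (n + 1), max (B k - t) 0 := by
            refine (Finset.sum_subset (Finset.range_mono hn) fun k hk hk' => ?_).symm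
            have hkN : k < N := Finset.mem_range.1 hk
            simp only [B, hkN, dif_pos]
            refine max_eq_right (sub_nonpos.2 (hbanti (Fin.mk_le_mk.2 ?_)))
            simp only [Finset.mem_range] at hk'
            omega
        _ = _ := by
            refine Finset.sum_congr rfl fun k hk => max_eq_left ?_
            have hk' := Finset.mem_range.1 hk
            have hkN : k < N := by omega
            simp only [B, hkN, dif_pos]
            exact sub_nonneg.2 (hbanti (Fin.mk_le_mk.2 (by omega)))
    have h3 := h t (hb _)
    rw [h2] at h3
    have h4 := h1.trans h3
    rw [Finset.sum_sub_distrib, Finset.sum_sub_distrib] at h4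
    rw [Finset.sum_sub_distrib]
    linarith
  · rw [Finset.sum_sub_distrib, ← Fin.sum_univ_eq_sum_range B, ← Fin.sum_univ_eq_sum_range A]
    simp only [A, B, Fin.is_lt, dif_pos, Fin.eta]
    rw [f.sum_comp b, e.sum_comp a, hsum, sub_self]

/-- A majorized family is a convex combination of rearrangements of the majorizing one: a separating
hyperplane would contradict the rearrangement inequality `Majorizes.exists_perm_sum_le`. -/
lemma Majorizes.mem_convexHull {ι : Type} [Fintype ι] {a b : ι → ℝ} (h : Majorizes b a)
    (hb : ∀ i, 0 ≤ b i) (hsum : ∑ i, a i = ∑ i, b i) :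
    a ∈ convexHull ℝ (Set.range fun σ : Equiv.Perm ι => b ∘ σ) := by
  classical
  by_contra hmem
  obtain ⟨g, u, hg, hu⟩ := geometric_hahn_banach_closed_point (convex_convexHull ℝ _)
    ((Set.finite_range fun σ : Equiv.Perm ι => b ∘ σ).isClosed_convexHull ℝ) hmem
  have hrep : ∀ x : ι → ℝ, g x = ∑ i, g (Pi.single i 1) * x i := by
    intro x
    conv_lhs => rw [pi_eq_sum_univ' x]
    rw [map_sum]
    refine Finset.sum_congr rfl fun i _ => ?_
    rw [map_smul, smul_eq_mul, mul_comm]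
  obtain ⟨σ, hσ⟩ := h.exists_perm_sum_le hb hsum fun i => g (Pi.single i 1)
  have h1 := hg _ (subset_convexHull ℝ _ ⟨σ, rfl⟩)
  rw [hrep] at h1 hu
  simp only [Function.comp_apply] at h1
  linarith

/-- A majorized family is a probabilistic mixture of embeddings of the majorizing one into the
larger index type. -/
lemma Majorizes.exists_mixture {ι κ : Type} [Fintype ι] [DecidableEq ι] [Fintype κ]
    {a : ι → ℝ} {b : κ → ℝ} (h : Majorizes b a) (hb : ∀ j, 0 ≤ b j)
    (hsum : ∑ i, a i = ∑ j, b j) (hcard : Fintype.card κ ≤ Fintype.card ι) :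
    ∃ (X : Type) (_ : Fintype X) (p : X → ℝ) (f : X → κ ↪ ι), (∀ x, 0 ≤ p x) ∧ ∑ x, p x = 1 ∧
      ∀ i, a i = ∑ x, ∑ j, if f x j = i then p x * b j else 0 := by
  classical
  obtain ⟨e⟩ : Nonempty (κ ↪ ι) := Function.Embedding.nonempty_of_card_le hcard
  set b' : ι → ℝ := fun i => ∑ j, if e j = i then b j else 0
  have hb'e : ∀ j, b' (e j) = b j := fun j => by simp [b', e.injective.eq_iff]
  have hb'0 : ∀ i, i ∉ Set.range e → b' i = 0 := by
    intro i hi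
    refine Finset.sum_eq_zero fun j _ => if_neg fun hj => hi ⟨j, hj⟩
  have hsumG : ∀ G : ℝ → ℝ, G 0 = 0 → ∑ i, G (b' i) = ∑ j, G (b j) := by
    intro G hG
    calc ∑ i, G (b' i) = ∑ i ∈ Finset.univ.map e, G (b' i) := by
          refine (Finset.sum_subset (Finset.subset_univ _) fun i _ hi => ?_).symm
          rw [hb'0 i fun ⟨j, hj⟩ => hi (by simp [← hj]), hG]
      _ = _ := by simp [hb'e]
  have hmaj : Majorizes b' a := by
    intro t ht
    rw [hsumG (fun y => max (y - t) 0) (by simpa using ht)]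
    exact h t ht
  have hnonneg : ∀ i, 0 ≤ b' i := fun i => Finset.sum_nonneg fun j _ => by
    split_ifs
    exacts [hb j, le_rfl]
  have hmem := hmaj.mem_convexHull hnonneg (hsum.trans (hsumG id rfl).symm)
  obtain ⟨X, hX, p, z, hp, hp1, hz, hsum'⟩ := mem_convexHull_iff_exists_fintype.1 hmem
  choose σ hσ using hz
  refine ⟨X, hX, p, fun x => e.trans (σ x).symm.toEmbedding, hp, hp1, fun i => ?_⟩
  rw [← hsum', Finset.sum_apply]
  refine Finset.sum_congr rfl fun x _ => ?_
  rw [← hσ x]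
  simp [b', Finset.mul_sum, Equiv.symm_apply_eq]

end Mixture

/-! ### Majorization is sufficient -/

section Protocol

variable {A B C D : Type} [Fintype A] [DecidableEq A] [Fintype B] [DecidableEq B]
  [Fintype C] [DecidableEq C] [Fintype D] [DecidableEq D]

/-- A measurement by Alice with outcomes in an arbitrary finite type. -/
lemma IsLOCC.alice_fintype {X Y : Type} [Fintype X] [Fintype Y] [DecidableEq Y]
    (K : X → Matrix Y A ℂ) (hK : ∑ x, (K x)ᴴ * K x = 1)
    (E : X → Matrix (Y × B) (Y × B) ℂ → Matrix (C × D) (C × D) ℂ)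
    (hE : ∀ x, IsLOCC C D Y B (E x)) :
    IsLOCC C D A B (fun ρ => ∑ x,
      E x ((K x ⊗ₖ (1 : Matrix B B ℂ)) * ρ * (K x ⊗ₖ (1 : Matrix B B ℂ))ᴴ)) := by
  let e := (Fintype.equivFin X).symm
  have h := IsLOCC.alice (A' := C) (B' := D) A B (Fintype.card X) (fun _ => Y) (fun x => K (e x))
    (by rw [← hK, ← e.sum_comp]) (fun x => E (e x)) (fun x => hE _)
  convert h using 2 with ρ
  exact (e.sum_comp _).symm

/-- A measurement by Bob with outcomes in an arbitrary finite type. -/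
lemma IsLOCC.bob_fintype {X Y : Type} [Fintype X] [Fintype Y] [DecidableEq Y]
    (K : X → Matrix Y B ℂ) (hK : ∑ x, (K x)ᴴ * K x = 1)
    (E : X → Matrix (A × Y) (A × Y) ℂ → Matrix (C × D) (C × D) ℂ)
    (hE : ∀ x, IsLOCC C D A Y (E x)) :
    IsLOCC C D A B (fun ρ => ∑ x,
      E x (((1 : Matrix A A ℂ) ⊗ₖ K x) * ρ * ((1 : Matrix A A ℂ) ⊗ₖ K x)ᴴ)) := by
  let e := (Fintype.equivFin X).symm
  have h := IsLOCC.bob (A' := C) (B' := D) A B (Fintype.card X) (fun _ => Y) (fun x => K (e x))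
    (by rw [← hK, ← e.sum_comp]) (fun x => E (e x)) (fun x => hE _)
  convert h using 2 with ρ
  exact (e.sum_comp _).symm

variable {ι κ : Type} [Fintype κ] [DecidableEq ι]

/-- Alice's Kraus operator for the embedding `f`: it moves the coefficient at `f j` to position `j`
and rescales it from `√(α (f j))` to `√(p * β j)`. -/
noncomputable def filterKraus (α : ι → ℝ) (β : κ → ℝ) (p : ℝ) (f : κ ↪ ι) : Matrix κ ι ℂ :=
  fun j i => if f j = i then (Real.sqrt (p * β j / α i) : ℂ) else 0

lemma filterKraus_conjTranspose_mul_self {α : ι → ℝ} (h0 : ∀ i, 0 < α i) {β : κ → ℝ}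
    (k0 : ∀ j, 0 ≤ β j) {p : ℝ} (hp : 0 ≤ p) (f : κ ↪ ι) :
    (filterKraus α β p f)ᴴ * filterKraus α β p f =
      diagonal fun i => (((∑ j, if f j = i then p * β j else 0) / α i : ℝ) : ℂ) := by
  ext i i'
  rw [mul_apply, diagonal_apply]
  split_ifs with h
  · subst h
    rw [Finset.sum_div, Complex.ofReal_sum]
    refine Finset.sum_congr rfl fun j _ => ?_
    by_cases hj : f j = i
    · have : 0 ≤ p * β j / α i := div_nonneg (mul_nonneg hp (k0 j)) (h0 i).le
      simp only [filterKraus, conjTranspose_apply, hj, if_true]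
      rw [Complex.star_def, Complex.conj_ofReal, ← Complex.ofReal_mul, Real.mul_self_sqrt this]
    · simp [filterKraus, conjTranspose_apply, hj]
  · refine Finset.sum_eq_zero fun j _ => ?_
    by_cases hj : f j = i
    · have : f j ≠ i' := fun h' => h (hj.symm.trans h')
      simp [filterKraus, this]
    · simp [filterKraus, conjTranspose_apply, hj]

variable [DecidableEq κ]

/-- Bob's Kraus operators for the embedding `f`: the outcome `none` moves position `f j` to `j`,
and the outcome `some i` catches a position `i` outside the range of `f`. -/
def pullbackKraus (f : κ ↪ ι) (j₀ : κ) : Option ι → Matrix κ ι ℂ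
  | none => fun j i => if f j = i then 1 else 0
  | some i' => fun j i => if j = j₀ ∧ i = i' ∧ ∀ l, f l ≠ i then 1 else 0

lemma pullbackKraus_none_apply (f : κ ↪ ι) (j₀ j : κ) (i : ι) :
    pullbackKraus f j₀ none j i = if f j = i then 1 else 0 := rfl

lemma pullbackKraus_some_apply (f : κ ↪ ι) (j₀ j : κ) (i' i : ι) :
    pullbackKraus f j₀ (some i') j i = if j = j₀ ∧ i = i' ∧ ∀ l, f l ≠ i then 1 else 0 := rfl

variable [Fintype ι]

lemma sum_pullbackKraus (f : κ ↪ ι) (j₀ : κ) :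
    ∑ o, (pullbackKraus f j₀ o)ᴴ * pullbackKraus f j₀ o = 1 := by
  ext i i'
  rw [Fintype.sum_option, Matrix.add_apply, Matrix.sum_apply]
  simp only [mul_apply, conjTranspose_apply, pullbackKraus_none_apply, pullbackKraus_some_apply]
  by_cases hi : ∃ l, f l = i
  · obtain ⟨l, rfl⟩ := hi
    simp only [EmbeddingLike.apply_eq_iff_eq, one_apply]
    by_cases h : f l = i'
    · subst h
      simp
    · have : ∀ x, (if f x = i' then if x = l then (1 : ℂ) else 0 else 0) = 0 := by grind
      simp [h, this]
  · push Not at hi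
    by_cases hii : i = i'
    · subst hii
      simp [hi, ite_and]
    · have : ∀ j o, ¬ (j = j₀ ∧ i = o ∧ ∀ l, f l ≠ i) ∨ ¬ (j = j₀ ∧ i' = o ∧ ∀ l, f l ≠ i') := by
        grind
      have h0 : ∀ j o, star (if j = j₀ ∧ i = o ∧ ∀ l, f l ≠ i then (1 : ℂ) else 0) *
          (if j = j₀ ∧ i' = o ∧ ∀ l, f l ≠ i' then 1 else 0) = 0 := by
        intro j o
        rcases this j o with h | h <;> simp [h]
      simp only [h0, hi, one_apply, hii]
      simp

/-- The sufficiency half of Nielsen's theorem, for a source with nonzero coefficients and at least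
as many of them as the target. If the source coefficients are a mixture, with weights `p x`, of the
target coefficients embedded by `f x`, then Alice measures with the Kraus operators `filterKraus`
and Bob moves his system accordingly. -/
theorem PureState.convertsTo_of_majorizes {α : ι → ℝ} {h0 : ∀ i, 0 ≤ α i} {h1 : ∑ i, α i = 1}
    {β : κ → ℝ} {k0 : ∀ j, 0 ≤ β j} {k1 : ∑ j, β j = 1} (hpos : ∀ i, 0 < α i)
    (hcard : Fintype.card κ ≤ Fintype.card ι) (h : Majorizes β α) :
    (ofSchmidt α h0 h1).ConvertsTo (ofSchmidt β k0 k1) := by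
  obtain ⟨X, hX, p, f, hp, hp1, hmix⟩ := h.exists_mixture k0 (h1.trans k1.symm) hcard
  obtain ⟨j₀⟩ : Nonempty κ := by
    by_contra hne
    rw [not_nonempty_iff] at hne
    simp at k1
  have hK : ∑ x, (filterKraus α β (p x) (f x))ᴴ * filterKraus α β (p x) (f x) = 1 := by
    simp only [filterKraus_conjTranspose_mul_self hpos k0 (hp _)]
    ext i i'
    rw [Matrix.sum_apply, one_apply]
    simp only [diagonal_apply]
    split_ifs with hii
    · rw [← Complex.ofReal_sum, ← Finset.sum_div, ← hmix, div_self (hpos i).ne', Complex.ofReal_one]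
    · simp
  refine ⟨_, IsLOCC.alice_fintype (fun x => filterKraus α β (p x) (f x)) hK _ fun x =>
    IsLOCC.bob_fintype (pullbackKraus (f x) j₀) (sum_pullbackKraus _ _) (fun _ ρ => ρ)
      fun _ => IsLOCC.finish, ?_⟩
  simp only [density_eq_pureOp, kronecker_one_conj_pureOp, one_kronecker_conj_pureOp,
    ampMatrix_ofSchmidt, Fintype.sum_option]
  set Φ : Matrix κ κ ℂ := diagonal fun j => (Real.sqrt (β j) : ℂ)
  have hAlice : ∀ x j i, (filterKraus α β (p x) (f x) * diagonal fun i => (Real.sqrt (α i) : ℂ)) j i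
      = if f x j = i then (Real.sqrt (p x * β j) : ℂ) else 0 := by
    intro x j i
    rw [mul_diagonal, filterKraus]
    split_ifs
    · rw [← Complex.ofReal_mul, ← Real.sqrt_mul (div_nonneg (mul_nonneg (hp x) (k0 j)) (h0 i)),
        div_mul_cancel₀ _ (hpos i).ne']
    · simp
  have hnone : ∀ x, (filterKraus α β (p x) (f x) * diagonal fun i => (Real.sqrt (α i) : ℂ)) *
      (pullbackKraus (f x) j₀ none)ᵀ = (Real.sqrt (p x) : ℂ) • Φ := by
    intro x
    ext j j'
    rw [mul_apply]
    simp only [hAlice, transpose_apply, pullbackKraus_none_apply]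
    by_cases hj : j = j'
    · subst hj
      simp [Φ, Real.sqrt_mul (hp x)]
    · simp [Φ, hj]
  have hsome : ∀ x i, (filterKraus α β (p x) (f x) * diagonal fun i => (Real.sqrt (α i) : ℂ)) *
      (pullbackKraus (f x) j₀ (some i))ᵀ = 0 := by
    intro x i
    ext j j'
    rw [mul_apply]
    refine Finset.sum_eq_zero fun i' _ => ?_
    rw [hAlice]
    by_cases hj : f x j = i'
    · have : ¬ ∀ l, f x l ≠ i' := fun h => h j hj
      simp [pullbackKraus_some_apply, this]
    · simp [hj]
  have hzero : pureOp (0 : Matrix κ κ ℂ) = 0 := by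
    ext; simp [pureOp_apply]
  have hsmul : ∀ c : ℂ, pureOp (c • Φ) = (‖c‖ ^ 2 : ℂ) • pureOp Φ := by
    intro c
    ext q r
    simp only [pureOp_apply, Matrix.smul_apply, smul_eq_mul, star_mul', ← Complex.mul_conj']
    simp only [Complex.star_def]
    ring
  simp only [hnone, hsome, hzero, Finset.sum_const_zero, add_zero, hsmul]
  rw [← Finset.sum_smul]
  have : ∑ x, ((‖(Real.sqrt (p x) : ℂ)‖ : ℂ) ^ 2) = 1 := by
    rw [← Complex.ofReal_one, ← hp1, Complex.ofReal_sum]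
    refine Finset.sum_congr rfl fun x _ => ?_
    rw [Complex.norm_real, Real.norm_eq_abs, ← Complex.ofReal_pow, sq_abs, Real.sq_sqrt (hp x)]
  rw [this, one_smul]

end Protocol

/-! ### Majorization for products -/

section Products

variable {ι κ ι' κ' : Type} [Fintype ι] [Fintype κ] [Fintype ι'] [Fintype κ']

/-- The product of the letters of a word `x` of length `m`, where the letter `i` has the value `α i`.
If `α` lists the Schmidt coefficients of a state, these are the Schmidt coefficients of `m` copies. -/
def wordProd {ι M : Type} [CommMonoid M] (α : ι → M) (m : ℕ) (x : Fin m → ι) : M := ∏ i, α (x i)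

lemma sum_wordProd {R : Type} [CommSemiring R] (α : ι → R) (m : ℕ) :
    ∑ x, wordProd α m x = (∑ i, α i) ^ m := (Fintype.sum_pow α m).symm

lemma wordProd_nonneg {ι : Type} {α : ι → ℝ} (h0 : ∀ i, 0 ≤ α i) (m : ℕ) (x : Fin m → ι) :
    0 ≤ wordProd α m x := Finset.prod_nonneg fun _ _ => h0 _

lemma wordProd_pos {ι : Type} {α : ι → ℝ} (h0 : ∀ i, 0 < α i) (m : ℕ) (x : Fin m → ι) :
    0 < wordProd α m x := Finset.prod_pos fun _ _ => h0 _

lemma sum_wordProd_eq_one {α : ι → ℝ} (h1 : ∑ i, α i = 1) (m : ℕ) :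
    ∑ x, wordProd α m x = 1 := by rw [sum_wordProd, h1, one_pow]

lemma sum_mul_eq_one {α : ι → ℝ} {β : κ → ℝ} (h1 : ∑ i, α i = 1) (k1 : ∑ j, β j = 1) :
    ∑ p : ι × κ, α p.1 * β p.2 = 1 := by
  rw [Fintype.sum_prod_type, ← Fintype.sum_mul_sum, h1, k1, one_mul]

namespace PureState

lemma tpow_ofSchmidt [DecidableEq ι] (α : ι → ℝ) (h0 : ∀ i, 0 ≤ α i) (h1 : ∑ i, α i = 1) (m : ℕ) :
    (ofSchmidt α h0 h1).tpow m =
      ofSchmidt (wordProd α m) (wordProd_nonneg h0 m) (sum_wordProd_eq_one h1 m) := by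
  simp only [tpow, ofSchmidt, mk.injEq]
  funext p
  by_cases h : p.1 = p.2
  · simp only [h, if_true, wordProd]
    rw [Real.sqrt_prod _ fun i _ => h0 _, Complex.ofReal_prod]
  · obtain ⟨i, hi⟩ := Function.ne_iff.1 h
    rw [if_neg h]
    exact Finset.prod_eq_zero (Finset.mem_univ i) (if_neg hi)

lemma tensor_ofSchmidt [DecidableEq ι] [DecidableEq κ] (α : ι → ℝ) (h0 : ∀ i, 0 ≤ α i)
    (h1 : ∑ i, α i = 1) (β : κ → ℝ) (k0 : ∀ j, 0 ≤ β j) (k1 : ∑ j, β j = 1) :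
    (ofSchmidt α h0 h1).tensor (ofSchmidt β k0 k1) =
      ofSchmidt (fun p : ι × κ => α p.1 * β p.2) (fun _ => mul_nonneg (h0 _) (k0 _))
        (sum_mul_eq_one h1 k1) := by
  simp only [tensor, ofSchmidt, mk.injEq]
  funext p
  obtain ⟨⟨a, c⟩, b, d⟩ := p
  by_cases hab : a = b <;> by_cases hcd : c = d <;> simp [hab, hcd, Real.sqrt_mul (h0 _)]

end PureState

lemma Majorizes.refl (a : ι → ℝ) : Majorizes a a := fun _ _ => le_rfl

lemma Majorizes.trans {c : ι' → ℝ} {b : κ → ℝ} {a : ι → ℝ} (h : Majorizes c b)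
    (h' : Majorizes b a) : Majorizes c a := fun t ht => (h' t ht).trans (h t ht)

lemma Majorizes.sum_max_mul_le {b : κ → ℝ} {a : ι → ℝ} (h : Majorizes b a) {c t : ℝ} (hc : 0 ≤ c)
    (ht : 0 ≤ t) : ∑ i, max (a i * c - t) 0 ≤ ∑ j, max (b j * c - t) 0 := by
  rcases hc.eq_or_lt with rfl | hc
  · have : max (-t) 0 = 0 := max_eq_right (by linarith)
    simp [this]
  · have key : ∀ y : ℝ, max (y * c - t) 0 = max (y - t / c) 0 * c := by
      intro y
      rw [max_mul_of_nonneg _ _ hc.le, sub_mul, div_mul_cancel₀ _ hc.ne', zero_mul]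
    simp only [key, ← Finset.sum_mul]
    exact mul_le_mul_of_nonneg_right (h _ (div_nonneg ht hc.le)) hc.le

/-- Majorization is stable under tensor products. -/
lemma Majorizes.tensor {b : κ → ℝ} {a : ι → ℝ} {d : κ' → ℝ} {c : ι' → ℝ} (h : Majorizes b a)
    (h' : Majorizes d c) (hb : ∀ j, 0 ≤ b j) (hc : ∀ i, 0 ≤ c i) :
    Majorizes (fun p : κ × κ' => b p.1 * d p.2) (fun p : ι × ι' => a p.1 * c p.2) := by
  intro t ht
  rw [Fintype.sum_prod_type_right, Fintype.sum_prod_type]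
  calc ∑ k, ∑ i, max (a i * c k - t) 0 ≤ ∑ k, ∑ j, max (b j * c k - t) 0 :=
        Finset.sum_le_sum fun k _ => h.sum_max_mul_le (hc k) ht
    _ = ∑ j, ∑ k, max (c k * b j - t) 0 := by
        rw [Finset.sum_comm]
        simp only [mul_comm]
    _ ≤ ∑ j, ∑ l, max (d l * b j - t) 0 :=
        Finset.sum_le_sum fun j _ => h'.sum_max_mul_le (hb j) ht
    _ = _ := by simp only [mul_comm]

lemma sum_wordProd_add {M : Type} [CommMonoid M] (α : ι → M) (m n : ℕ) (F : M → ℝ) :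
    ∑ x, F (wordProd α (m + n) x) =
      ∑ p : (Fin m → ι) × (Fin n → ι), F (wordProd α m p.1 * wordProd α n p.2) := by
  rw [← (Fin.appendEquiv m n).sum_comp]
  simp [wordProd, Fin.prod_univ_add, Fin.appendEquiv]

lemma Majorizes.wordProd_one {β : κ → ℝ} {α : ι → ℝ} (h : Majorizes β α) :
    Majorizes (wordProd β 1) (wordProd α 1) := by
  intro t ht
  rw [← (Equiv.funUnique (Fin 1) ι).symm.sum_comp, ← (Equiv.funUnique (Fin 1) κ).symm.sum_comp]
  simpa [wordProd] using h t ht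

lemma Majorizes.wordProd_add {β : κ → ℝ} {α : ι → ℝ} {m m' n n' : ℕ}
    (h : Majorizes (wordProd β n) (wordProd α m))
    (h' : Majorizes (wordProd β n') (wordProd α m'))
    (hβ : ∀ j, 0 ≤ β j) (hα : ∀ i, 0 ≤ α i) :
    Majorizes (wordProd β (n + n')) (wordProd α (m + m')) := by
  intro t ht
  rw [sum_wordProd_add α m m' fun y => max (y - t) 0,
    sum_wordProd_add β n n' fun y => max (y - t) 0]
  exact h.tensor h' (wordProd_nonneg hβ n) (wordProd_nonneg hα m') t ht

/-- Two conversions that borrow the same catalyst `c` can be run one after the other. -/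
lemma Majorizes.wordProd_add_catalyst {β : κ → ℝ} {α : ι → ℝ} {c : ι' → ℝ} {m m' n n' : ℕ}
    (h : Majorizes (fun p : (Fin n → κ) × ι' => wordProd β n p.1 * c p.2)
      (fun p : (Fin m → ι) × ι' => wordProd α m p.1 * c p.2))
    (h' : Majorizes (fun p : (Fin n' → κ) × ι' => wordProd β n' p.1 * c p.2)
      (fun p : (Fin m' → ι) × ι' => wordProd α m' p.1 * c p.2))
    (hβ : ∀ j, 0 ≤ β j) (hα : ∀ i, 0 ≤ α i) :
    Majorizes (fun p : (Fin (n + n') → κ) × ι' => wordProd β (n + n') p.1 * c p.2)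
      (fun p : (Fin (m + m') → ι) × ι' => wordProd α (m + m') p.1 * c p.2) := by
  intro t ht
  rw [Fintype.sum_prod_type, Fintype.sum_prod_type,
    sum_wordProd_add α m m' fun y => ∑ k, max (y * c k - t) 0,
    sum_wordProd_add β n n' fun y => ∑ k, max (y * c k - t) 0]
  calc ∑ p : (Fin m → ι) × (Fin m' → ι), ∑ k, max (wordProd α m p.1 * wordProd α m' p.2 * c k - t) 0
      = ∑ x, ∑ p : (Fin m' → ι) × ι', max (wordProd α m' p.1 * c p.2 * wordProd α m x - t) 0 := by
        simp only [Fintype.sum_prod_type, mul_comm, mul_left_comm]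
    _ ≤ ∑ x, ∑ p : (Fin n' → κ) × ι', max (wordProd β n' p.1 * c p.2 * wordProd α m x - t) 0 :=
        Finset.sum_le_sum fun x _ => h'.sum_max_mul_le (wordProd_nonneg hα m x) ht
    _ = ∑ y, ∑ p : (Fin m → ι) × ι', max (wordProd α m p.1 * c p.2 * wordProd β n' y - t) 0 := by
        simp only [Fintype.sum_prod_type, mul_comm, mul_left_comm]
        exact Finset.sum_comm
    _ ≤ ∑ y, ∑ p : (Fin n → κ) × ι', max (wordProd β n p.1 * c p.2 * wordProd β n' y - t) 0 :=
        Finset.sum_le_sum fun y _ => h.sum_max_mul_le (wordProd_nonneg hβ n' y) ht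
    _ = _ := by
        rw [Fintype.sum_prod_type_right]
        simp only [Fintype.sum_prod_type, mul_comm, mul_left_comm]

/-- An auxiliary state can be discarded. -/
lemma majorizes_mul_of_sum_eq_one (a : ι → ℝ) {c : κ → ℝ} (hc : ∀ k, 0 ≤ c k)
    (hc1 : ∑ k, c k = 1) : Majorizes a (fun p : ι × κ => a p.1 * c p.2) := by
  intro t ht
  rw [Fintype.sum_prod_type]
  refine Finset.sum_le_sum fun i _ => ?_
  calc ∑ k, max (a i * c k - t) 0 ≤ ∑ k, c k * max (a i - t) 0 := by
        refine Finset.sum_le_sum fun k _ => max_le ?_ (mul_nonneg (hc k) (le_max_right _ _))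
        have h1 : c k ≤ 1 := by
          rw [← hc1]
          exact Finset.single_le_sum (fun j _ => hc j) (Finset.mem_univ k)
        have h2 := mul_le_mul_of_nonneg_left (le_max_left (a i - t) 0) (hc k)
        have h3 := mul_le_mul_of_nonneg_right h1 ht
        linarith
    _ = max (a i - t) 0 := by rw [← Finset.sum_mul, hc1, one_mul]

lemma Majorizes.le_of_forall_le {b : κ → ℝ} {a : ι → ℝ} (h : Majorizes b a) {t : ℝ} (ht : 0 ≤ t)
    (hb : ∀ j, b j ≤ t) (i : ι) : a i ≤ t := by
  have h1 : ∑ j, max (b j - t) 0 = 0 :=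
    Finset.sum_eq_zero fun j _ => max_eq_right (sub_nonpos.2 (hb j))
  have h2 : max (a i - t) 0 ≤ ∑ i, max (a i - t) 0 :=
    Finset.single_le_sum (f := fun i => max (a i - t) 0) (fun i _ => le_max_right _ _)
      (Finset.mem_univ i)
  have h3 := h t ht
  have h4 := le_max_left (a i - t) 0
  linarith

end Products

/-! ### Reduction to finitely many integer inequalities -/

section Breakpoints

variable {ι κ : Type} [Fintype ι] [Fintype κ]

/-- It suffices to test majorization at the entries of `b`: between two neighbouring ones the
right-hand side is affine in `t`, whereas the left-hand side is convex. -/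
lemma majorizes_of_forall_entry {a : ι → ℝ} {b : κ → ℝ} (ha : ∀ i, 0 ≤ a i) (hb : ∀ j, 0 ≤ b j)
    (hsum : ∑ i, a i ≤ ∑ j, b j)
    (h : ∀ l, ∑ i, max (a i - b l) 0 ≤ ∑ j, max (b j - b l) 0) : Majorizes b a := by
  intro t ht
  obtain ⟨u, hu0, hut, hu, hbu⟩ : ∃ u, 0 ≤ u ∧ u ≤ t ∧
      ∑ i, max (a i - u) 0 ≤ ∑ j, max (b j - u) 0 ∧ ∀ j, b j ≤ t → b j ≤ u := by
    by_cases hne : (Finset.univ.filter fun j => b j ≤ t).Nonempty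
    · obtain ⟨l, hl, hmax⟩ := Finset.exists_max_image _ b hne
      exact ⟨b l, hb l, (Finset.mem_filter.1 hl).2, h l, fun j hj => hmax j (by simpa using hj)⟩
    · refine ⟨0, le_rfl, ht, ?_, fun j hj => absurd ⟨j, by simpa using hj⟩ hne⟩
      simpa [ha, hb] using hsum
  by_cases hne : (Finset.univ.filter fun j => t < b j).Nonempty
  · obtain ⟨l, hl, hmin⟩ := Finset.exists_min_image _ b hne
    have htl : t < b l := (Finset.mem_filter.1 hl).2
    have hbl : ∀ j, b j ≤ u ∨ b l ≤ b j := fun j => by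
      rcases le_or_gt (b j) t with hj | hj
      · exact Or.inl (hbu j hj)
      · exact Or.inr (hmin j (by simpa using hj))
    -- `t` lies between the neighbouring breakpoints `u` and `b l`.
    set s := (t - u) / (b l - u)
    have hd : 0 < b l - u := by linarith
    have hs0 : 0 ≤ s := div_nonneg (by linarith) hd.le
    have hs1 : s ≤ 1 := (div_le_one hd).2 (by linarith)
    have hts : t = (1 - s) * u + s * b l := by
      have : s * (b l - u) = t - u := div_mul_cancel₀ _ hd.ne'
      linarith
    have hleft : ∀ i, max (a i - t) 0 ≤ (1 - s) * max (a i - u) 0 + s * max (a i - b l) 0 := by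
      intro i
      have h1 := mul_le_mul_of_nonneg_left (le_max_left (a i - u) 0) (sub_nonneg.2 hs1)
      have h2 := mul_le_mul_of_nonneg_left (le_max_left (a i - b l) 0) hs0
      have h3 := mul_nonneg (sub_nonneg.2 hs1) (le_max_right (a i - u) 0)
      have h4 := mul_nonneg hs0 (le_max_right (a i - b l) 0)
      refine max_le ?_ (by linarith)
      rw [hts]
      linarith
    have hright : ∀ j, (1 - s) * max (b j - u) 0 + s * max (b j - b l) 0 = max (b j - t) 0 := by
      intro j
      rcases hbl j with hj | hj
      · rw [max_eq_right (by linarith), max_eq_right (by linarith), max_eq_right (by linarith)]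
        ring
      · rw [max_eq_left (by linarith), max_eq_left (by linarith), max_eq_left (by linarith), hts]
        ring
    calc ∑ i, max (a i - t) 0
        ≤ ∑ i, ((1 - s) * max (a i - u) 0 + s * max (a i - b l) 0) :=
          Finset.sum_le_sum fun i _ => hleft i
      _ = (1 - s) * ∑ i, max (a i - u) 0 + s * ∑ i, max (a i - b l) 0 := by
          rw [Finset.sum_add_distrib, Finset.mul_sum, Finset.mul_sum]
      _ ≤ (1 - s) * ∑ j, max (b j - u) 0 + s * ∑ j, max (b j - b l) 0 :=
          add_le_add (mul_le_mul_of_nonneg_left hu (sub_nonneg.2 hs1))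
            (mul_le_mul_of_nonneg_left (h l) hs0)
      _ = ∑ j, max (b j - t) 0 := by
          rw [Finset.mul_sum, Finset.mul_sum, ← Finset.sum_add_distrib]
          exact Finset.sum_congr rfl fun j _ => hright j
  · have hbt : ∀ j, b j ≤ t := fun j => by
      by_contra hj
      exact hne ⟨j, by simpa using hj⟩
    calc ∑ i, max (a i - t) 0 ≤ ∑ i, max (a i - u) 0 :=
          Finset.sum_le_sum fun i _ => max_le_max (by linarith) le_rfl
      _ ≤ ∑ j, max (b j - u) 0 := hu
      _ = 0 := Finset.sum_eq_zero fun j _ => max_eq_right (sub_nonpos.2 (hbu j (hbt j)))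
      _ ≤ _ := Finset.sum_nonneg fun j _ => le_max_right _ _

/-- Truncated subtraction of natural numbers computes the positive part of a difference of
fractions. -/
lemma max_div_sub_div {q r : ℕ} (hq : 0 < q) (hr : 0 < r) (x z : ℕ) :
    max ((x : ℝ) / q - z / r) 0 = ((x * r - z * q : ℕ) : ℝ) / (q * r) := by
  have hq' : (0 : ℝ) < q := by exact_mod_cast hq
  have hr' : (0 : ℝ) < r := by exact_mod_cast hr
  have e : (x : ℝ) / q - z / r = (x * r - z * q) / (q * r) := by
    field_simp
  rw [e]
  rcases le_total (z * q) (x * r) with h | h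
  · have h' : (z : ℝ) * q ≤ x * r := by exact_mod_cast h
    rw [max_eq_left (div_nonneg (by linarith) (by positivity))]
    push_cast [h]
    rfl
  · have h' : (x : ℝ) * r ≤ z * q := by exact_mod_cast h
    rw [max_eq_right (div_nonpos_of_nonpos_of_nonneg (by linarith) (by positivity)),
      Nat.sub_eq_zero_of_le h]
    simp

/-- The test of majorization at the threshold `z / r` in integer arithmetic. -/
lemma sum_max_le_iff_nat {x : ι → ℕ} {y : κ → ℕ} {q r : ℕ} (hq : 0 < q) (hr : 0 < r) (z : ℕ) :
    ∑ i, max ((x i : ℝ) / q - z / r) 0 ≤ ∑ j, max ((y j : ℝ) / r - z / r) 0 ↔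
      ∑ i, (x i * r - z * q) ≤ q * ∑ j, (y j - z) := by
  have hq' : (0 : ℝ) < q := by exact_mod_cast hq
  have hr' : (0 : ℝ) < r := by exact_mod_cast hr
  simp only [max_div_sub_div hq hr, max_div_sub_div hr hr]
  rw [← Finset.sum_div, ← Finset.sum_div, div_le_div_iff₀ (by positivity) (by positivity)]
  simp only [← Nat.sub_mul, Nat.cast_mul, ← Finset.sum_mul]
  rw [show (∑ j, ((y j - z : ℕ) : ℝ)) * r * (q * r) =
      (q * ∑ j, ((y j - z : ℕ) : ℝ)) * (r * r) by ring,
    mul_le_mul_iff_left₀ (by positivity)]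
  exact_mod_cast Iff.rfl

lemma majorizes_div_of_nat {x : ι → ℕ} {y : κ → ℕ} {q r : ℕ} (hq : 0 < q) (hr : 0 < r)
    (hx : ∑ i, x i = q) (hy : ∑ j, y j = r)
    (h : ∀ l, ∑ i, (x i * r - y l * q) ≤ q * ∑ j, (y j - y l)) :
    Majorizes (fun j => (y j : ℝ) / r) (fun i => (x i : ℝ) / q) := by
  refine majorizes_of_forall_entry (fun i => by positivity) (fun j => by positivity) ?_
    fun l => (sum_max_le_iff_nat hq hr _).2 (h l)
  rw [← Finset.sum_div, ← Finset.sum_div, ← Nat.cast_sum, ← Nat.cast_sum, hx, hy, div_self,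
    div_self] <;> positivity

lemma Majorizes.nat_le {x : ι → ℕ} {y : κ → ℕ} {q r : ℕ} (hq : 0 < q) (hr : 0 < r)
    (h : Majorizes (fun j => (y j : ℝ) / r) (fun i => (x i : ℝ) / q)) (z : ℕ) :
    ∑ i, (x i * r - z * q) ≤ q * ∑ j, (y j - z) :=
  (sum_max_le_iff_nat hq hr z).1 (h _ (by positivity))

end Breakpoints

/-! ### Grouping words by type -/

section Words

/-- The sum of `h` over the products of the words of length `m` in a letter `p` and `w` copies of
a letter `q`, with words of the same type collected. -/
def binaryTypeSum (p q w m : ℕ) (h : ℕ → ℕ) : ℕ :=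
  ∑ j ∈ Finset.range (m + 1), m.choose j * w ^ (m - j) * h (p ^ j * q ^ (m - j))

/-- The sum of `h` over the products of the words of length `m` in four letters, with words of the
same type collected. -/
def quaternaryTypeSum (p q r s m : ℕ) (h : ℕ → ℕ) : ℕ :=
  ∑ i ∈ Finset.range (m + 1), m.choose i * binaryTypeSum p q 1 i fun v =>
    binaryTypeSum r s 1 (m - i) fun w => h (v * w)

/-- The linear extension of `h` to formal sums of natural numbers. -/
noncomputable def formalSum (h : ℕ → ℕ) : MonoidAlgebra ℕ ℕ →+ ℕ :=
  MonoidAlgebra.liftNC (AddMonoidHom.id ℕ) h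

lemma formalSum_of (h : ℕ → ℕ) (v : ℕ) : formalSum h (MonoidAlgebra.of ℕ ℕ v) = h v := by
  simp [formalSum, MonoidAlgebra.of_apply]

/-- Words are collected by expanding a power of the formal sum of the letters. -/
lemma sum_comp_wordProd {ι : Type} [Fintype ι] (c : ι → ℕ) (m : ℕ) (h : ℕ → ℕ) :
    ∑ x, h (wordProd c m x) = formalSum h ((∑ i, MonoidAlgebra.of ℕ ℕ (c i)) ^ m) := by
  rw [Fintype.sum_pow, map_sum]
  refine Finset.sum_congr rfl fun x _ => ?_
  rw [← map_prod, formalSum_of, wordProd]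

lemma formalSum_natCast_mul (h : ℕ → ℕ) (n : ℕ) (z : MonoidAlgebra ℕ ℕ) :
    formalSum h (n * z) = n * formalSum h z := by
  rw [← nsmul_eq_mul, map_nsmul, smul_eq_mul]

lemma formalSum_binary_mul (p q w m : ℕ) (h : ℕ → ℕ) (z : MonoidAlgebra ℕ ℕ) :
    formalSum h ((MonoidAlgebra.of ℕ ℕ p + w * MonoidAlgebra.of ℕ ℕ q) ^ m * z) =
      ∑ j ∈ Finset.range (m + 1), m.choose j * w ^ (m - j) *
        formalSum h (MonoidAlgebra.of ℕ ℕ (p ^ j * q ^ (m - j)) * z) := by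
  rw [add_pow, Finset.sum_mul, map_sum]
  refine Finset.sum_congr rfl fun j _ => ?_
  rw [← formalSum_natCast_mul]
  congr 1
  simp only [map_mul, map_pow, Nat.cast_mul, Nat.cast_pow]
  ring

lemma formalSum_binary (p q w m : ℕ) (h : ℕ → ℕ) :
    formalSum h ((MonoidAlgebra.of ℕ ℕ p + w * MonoidAlgebra.of ℕ ℕ q) ^ m) =
      binaryTypeSum p q w m h := by
  have := formalSum_binary_mul p q w m h 1
  simpa only [mul_one, formalSum_of, binaryTypeSum] using this

lemma formalSum_of_mul (h : ℕ → ℕ) (v : ℕ) (z : MonoidAlgebra ℕ ℕ) :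
    formalSum h (MonoidAlgebra.of ℕ ℕ v * z) = formalSum (fun w => h (v * w)) z := by
  induction z using MonoidAlgebra.induction_linear with
  | zero => simp
  | add f g hf hg => rw [mul_add, map_add, map_add, hf, hg]
  | single a b => simp [formalSum, MonoidAlgebra.of_apply, MonoidAlgebra.single_mul_single]

lemma sum_binary (p q m : ℕ) (h : ℕ → ℕ) :
    ∑ x, h (wordProd ![p, q] m x) = binaryTypeSum p q 1 m h := by
  rw [sum_comp_wordProd, ← formalSum_binary]
  simp [Fin.sum_univ_two]

lemma sum_ternary (p q m : ℕ) (h : ℕ → ℕ) :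
    ∑ x, h (wordProd ![p, q, q] m x) = binaryTypeSum p q 2 m h := by
  rw [sum_comp_wordProd, ← formalSum_binary]
  congr 2
  simp [Fin.sum_univ_three, add_assoc, two_mul]

lemma sum_quaternary (p q r s m : ℕ) (h : ℕ → ℕ) :
    ∑ x, h (wordProd ![p, q, r, s] m x) = quaternaryTypeSum p q r s m h := by
  have hsplit : ∑ i, MonoidAlgebra.of ℕ ℕ (![p, q, r, s] i) =
      (MonoidAlgebra.of ℕ ℕ p + ((1 : ℕ) : MonoidAlgebra ℕ ℕ) * MonoidAlgebra.of ℕ ℕ q) +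
        (MonoidAlgebra.of ℕ ℕ r + ((1 : ℕ) : MonoidAlgebra ℕ ℕ) * MonoidAlgebra.of ℕ ℕ s) := by
    simp only [Fin.sum_univ_four, Nat.cast_one, one_mul, ← add_assoc]
    rfl
  rw [sum_comp_wordProd, hsplit, add_pow, map_sum, quaternaryTypeSum]
  refine Finset.sum_congr rfl fun i _ => ?_
  rw [mul_comm, formalSum_natCast_mul, formalSum_binary_mul]
  simp only [formalSum_of_mul, formalSum_binary]
  rfl

end Words

/-! ### Rényi entropies -/

section Entropy

variable {ι : Type} [Fintype ι] [DecidableEq ι]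

namespace PureState

/-- The Schmidt coefficients of `∑ i, √(α i) |i⟩|i⟩` are the numbers `α i`, up to order. -/
lemma map_schmidtCoeff_ofSchmidt (α : ι → ℝ) (h0 : ∀ i, 0 ≤ α i) (h1 : ∑ i, α i = 1) :
    Finset.univ.val.map (ofSchmidt α h0 h1).schmidtCoeff = Finset.univ.val.map α := by
  have hherm := Matrix.isHermitian_mul_conjTranspose_self (ofSchmidt α h0 h1).ampMatrix
  have hdiag : (ofSchmidt α h0 h1).ampMatrix * (ofSchmidt α h0 h1).ampMatrixᴴ =
      diagonal fun i => (α i : ℂ) := by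
    rw [ampMatrix_ofSchmidt, diagonal_conjTranspose, diagonal_mul_diagonal]
    congr 1
    funext i
    simp only [Pi.star_apply, Complex.star_def, Complex.conj_ofReal, ← Complex.ofReal_mul]
    rw [Real.mul_self_sqrt (h0 i)]
  have hroots : ((ofSchmidt α h0 h1).ampMatrix * (ofSchmidt α h0 h1).ampMatrixᴴ).charpoly.roots =
      Finset.univ.val.map fun i => (α i : ℂ) := by
    rw [hdiag, charpoly_diagonal, Polynomial.roots_prod]
    · simp
    · simp [Finset.prod_ne_zero_iff, Polynomial.X_sub_C_ne_zero]
  have h := hherm.roots_charpoly_eq_eigenvalues.symm.trans hroots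
  refine Multiset.map_injective Complex.ofReal_injective ?_
  rw [Multiset.map_map, Multiset.map_map]
  exact h

lemma sum_comp_schmidtCoeff_ofSchmidt (α : ι → ℝ) (h0 : ∀ i, 0 ≤ α i) (h1 : ∑ i, α i = 1)
    (F : ℝ → ℝ) : ∑ i, F ((ofSchmidt α h0 h1).schmidtCoeff i) = ∑ i, F (α i) := by
  have := congrArg (fun s => (s.map F).sum) (map_schmidtCoeff_ofSchmidt α h0 h1)
  simp only [Multiset.map_map] at this
  exact this

open scoped ComplexOrder in
lemma schmidtCoeff_nonneg {A B : Type} [Fintype A] [DecidableEq A] [Fintype B]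
    (ψ : PureState A B) (i : A) : 0 ≤ ψ.schmidtCoeff i :=
  (Matrix.posSemidef_self_mul_conjTranspose ψ.ampMatrix).eigenvalues_nonneg i

lemma sum_schmidtCoeff_ofSchmidt (α : ι → ℝ) (h0 : ∀ i, 0 ≤ α i) (h1 : ∑ i, α i = 1) :
    ∑ i, (ofSchmidt α h0 h1).schmidtCoeff i = 1 := by
  rw [← h1]
  exact sum_comp_schmidtCoeff_ofSchmidt α h0 h1 id

lemma renyiEntropy_nonneg {A B : Type} [Fintype A] [DecidableEq A] [Fintype B]
    (ψ : PureState A B) (h1 : ∑ i, ψ.schmidtCoeff i = 1) (τ : ℝ≥0∞) : 0 ≤ renyiEntropy τ ψ := by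
  have hle : ∀ i, ψ.schmidtCoeff i ≤ 1 := fun i => by
    rw [← h1]
    exact Finset.single_le_sum (fun j _ => ψ.schmidtCoeff_nonneg j) (Finset.mem_univ i)
  have hpow0 : 0 ≤ ∑ i, ψ.schmidtCoeff i ^ τ.toReal :=
    Finset.sum_nonneg fun i _ => Real.rpow_nonneg (ψ.schmidtCoeff_nonneg i) _
  unfold renyiEntropy
  split_ifs with hτ0 hτ1 hτt
  · rcases Nat.eq_zero_or_pos (Nat.card {i // ψ.schmidtCoeff i ≠ 0}) with h | h
    · rw [h, Nat.cast_zero, Real.logb_zero]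
    · exact Real.logb_nonneg one_lt_two (by exact_mod_cast h)
  · rw [neg_nonneg]
    exact Finset.sum_nonpos fun i _ => mul_nonpos_of_nonneg_of_nonpos (ψ.schmidtCoeff_nonneg i)
      (Real.logb_nonpos one_lt_two (ψ.schmidtCoeff_nonneg i) (hle i))
  · rw [neg_nonneg]
    exact Real.logb_nonpos one_lt_two (Real.iSup_nonneg ψ.schmidtCoeff_nonneg)
      (Real.iSup_le hle zero_le_one)
  · have hpos : 0 < τ.toReal := ENNReal.toReal_pos hτ0 hτt
    have hne : τ.toReal ≠ 1 := fun h => hτ1 (by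
      rw [← ENNReal.ofReal_toReal hτt, h, ENNReal.ofReal_one])
    rcases lt_or_gt_of_ne hne with hlt | hgt
    · refine mul_nonneg (one_div_nonneg.2 (by linarith)) (Real.logb_nonneg one_lt_two ?_)
      rw [← h1]
      refine Finset.sum_le_sum fun i _ => ?_
      exact Real.self_le_rpow_of_le_one (ψ.schmidtCoeff_nonneg i) (hle i) hlt.le
    · refine mul_nonneg_of_nonpos_of_nonpos (one_div_nonpos.2 (by linarith))
        (Real.logb_nonpos one_lt_two hpow0 ?_)
      rw [← h1]
      refine Finset.sum_le_sum fun i _ => ?_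
      exact Real.rpow_le_self_of_le_one (ψ.schmidtCoeff_nonneg i) (hle i) hgt.le

lemma renyiEntropy_two_ofSchmidt (α : ι → ℝ) (h0 : ∀ i, 0 ≤ α i) (h1 : ∑ i, α i = 1) :
    renyiEntropy 2 (ofSchmidt α h0 h1) = - Real.logb 2 (∑ i, α i ^ 2) := by
  have h := sum_comp_schmidtCoeff_ofSchmidt α h0 h1 (· ^ 2)
  have h2 : (2 : ℝ≥0∞) ≠ 1 := by norm_num
  simp only [renyiEntropy, OfNat.ofNat_ne_zero, h2, ENNReal.ofNat_ne_top, if_false,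
    ENNReal.toReal_ofNat, Real.rpow_two, h]
  norm_num

/-- Every order gives an upper bound on the entropy ratio. -/
lemma entropyRatio_le {A B C D : Type} [Fintype A] [DecidableEq A] [Fintype B] [Fintype C]
    [DecidableEq C] [Fintype D] (ψ : PureState A B) (φ : PureState C D)
    (hψ : ∑ i, ψ.schmidtCoeff i = 1) (hφ : ∑ i, φ.schmidtCoeff i = 1) (τ : ℝ≥0∞) :
    entropyRatio ψ φ ≤ renyiEntropy τ ψ / renyiEntropy τ φ := by
  refine ciInf_le ⟨0, ?_⟩ τ
  rintro _ ⟨σ, rfl⟩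
  exact div_nonneg (ψ.renyiEntropy_nonneg hψ σ) (φ.renyiEntropy_nonneg hφ σ)

end PureState

end Entropy

/-! ### The concrete states -/

section Example

/-- The Schmidt coefficients of the source state, multiplied by `50`. -/
def sourceNum : Fin 4 → ℕ := ![20, 18, 7, 5]

/-- The Schmidt coefficients of the target state, multiplied by `4`. -/
def targetNum : Fin 3 → ℕ := ![2, 1, 1]

/-- The Schmidt coefficients of the catalyst state, multiplied by `5`. -/
def catalystNum : Fin 2 → ℕ := ![3, 2]

/-- The Schmidt coefficients of the source state. -/
noncomputable def sourceCoeff (i : Fin 4) : ℝ := sourceNum i / (50 : ℕ)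

/-- The Schmidt coefficients of the target state. -/
noncomputable def targetCoeff (i : Fin 3) : ℝ := targetNum i / (4 : ℕ)

/-- The Schmidt coefficients of the catalyst state. -/
noncomputable def catalystCoeff (i : Fin 2) : ℝ := catalystNum i / (5 : ℕ)

lemma sourceCoeff_pos (i : Fin 4) : 0 < sourceCoeff i := by
  fin_cases i <;> norm_num [sourceCoeff, sourceNum]

lemma targetCoeff_pos (i : Fin 3) : 0 < targetCoeff i := by
  fin_cases i <;> norm_num [targetCoeff, targetNum]

lemma catalystCoeff_pos (i : Fin 2) : 0 < catalystCoeff i := by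
  fin_cases i <;> norm_num [catalystCoeff, catalystNum]

lemma sum_sourceCoeff : ∑ i, sourceCoeff i = 1 := by
  norm_num [sourceCoeff, sourceNum, Fin.sum_univ_succ]

lemma sum_targetCoeff : ∑ i, targetCoeff i = 1 := by
  norm_num [targetCoeff, targetNum, Fin.sum_univ_succ]

lemma sum_catalystCoeff : ∑ i, catalystCoeff i = 1 := by
  norm_num [catalystCoeff, catalystNum, Fin.sum_univ_succ]

namespace PureState

lemma ofSchmidt_congr {ι : Type} [Fintype ι] [DecidableEq ι] {α β : ι → ℝ} (h : α = β)
    (h0 : ∀ i, 0 ≤ α i) (h1 : ∑ i, α i = 1) (k0 : ∀ i, 0 ≤ β i) (k1 : ∑ i, β i = 1) :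
    ofSchmidt α h0 h1 = ofSchmidt β k0 k1 := by
  subst h
  rfl

lemma sourceState_eq :
    sourceState = ofSchmidt sourceCoeff (fun i => (sourceCoeff_pos i).le) sum_sourceCoeff :=
  ofSchmidt_congr (by
    funext i
    fin_cases i <;> norm_num [sourceCoeff, sourceNum]) _ _ _ _

lemma targetState_eq :
    targetState = ofSchmidt targetCoeff (fun i => (targetCoeff_pos i).le) sum_targetCoeff :=
  ofSchmidt_congr (by
    funext i
    fin_cases i <;> norm_num [targetCoeff, targetNum]) _ _ _ _

lemma catalystState_eq :
    catalystState = ofSchmidt catalystCoeff (fun i => (catalystCoeff_pos i).le)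
      sum_catalystCoeff :=
  ofSchmidt_congr (by
    funext i
    fin_cases i <;> norm_num [catalystCoeff, catalystNum]) _ _ _ _

end PureState

lemma wordProd_le_pow {ι : Type} {α : ι → ℝ} (h0 : ∀ i, 0 ≤ α i) {c : ℝ} (hc : ∀ i, α i ≤ c)
    (m : ℕ) (x : Fin m → ι) : wordProd α m x ≤ c ^ m :=
  (Finset.prod_le_prod (fun _ _ => h0 _) fun _ _ => hc _).trans_eq (by simp)

lemma wordProd_div {ι : Type} (c : ι → ℕ) (q m : ℕ) (x : Fin m → ι) :
    wordProd (fun i => (c i : ℝ) / q) m x = (wordProd c m x : ℕ) / ((q ^ m : ℕ) : ℝ) := by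
  simp [wordProd, Finset.prod_div_distrib]

lemma exists_wordProd_targetNum (n : ℕ) (x : Fin n → Fin 3) :
    ∃ s ∈ Finset.range (n + 1), wordProd targetNum n x = 2 ^ s := by
  have h : ∀ i : Fin 3, targetNum i = 2 ^ (if i = 0 then 1 else 0) := by decide
  refine ⟨∑ i, if x i = 0 then 1 else 0, ?_, ?_⟩
  · rw [Finset.mem_range, Nat.lt_succ_iff]
    calc ∑ i, (if x i = 0 then 1 else 0) ≤ ∑ _i : Fin n, 1 :=
          Finset.sum_le_sum fun i _ => by split_ifs <;> simp
      _ = n := by simp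
  · rw [← Finset.prod_pow_eq_pow_sum]
    exact Finset.prod_congr rfl fun i _ => h _

lemma exists_wordProd_catalystNum (n : ℕ) (x : Fin n → Fin 2) :
    ∃ u ∈ Finset.range (n + 1), wordProd catalystNum n x = 3 ^ u * 2 ^ (n - u) := by
  have h : ∀ i : Fin 2, catalystNum i = if i = 0 then 3 else 2 := by decide
  refine ⟨(Finset.univ.filter fun i => x i = 0).card, ?_, ?_⟩
  · rw [Finset.mem_range, Nat.lt_succ_iff]
    simpa using Finset.card_le_univ (Finset.univ.filter fun i => x i = 0)
  · simp only [wordProd, h, Finset.prod_ite, Finset.prod_const]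
    congr 2
    rw [Finset.filter_not, Finset.card_sdiff_of_subset (Finset.filter_subset _ _)]
    simp

lemma sum_wordProd_sourceNum (m : ℕ) : ∑ x, wordProd sourceNum m x = 50 ^ m := by
  rw [sum_wordProd]
  rfl

lemma sum_wordProd_targetNum (n : ℕ) : ∑ x, wordProd targetNum n x = 4 ^ n := by
  rw [sum_wordProd]
  rfl

lemma sum_wordProd_catalystNum (n : ℕ) : ∑ x, wordProd catalystNum n x = 5 ^ n := by
  rw [sum_wordProd]
  rfl

/-- For copies of the target state it suffices to test the thresholds `2 ^ s / 4 ^ n`, since these are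
the only values of the Schmidt coefficients. -/
lemma majorizes_copies {m n : ℕ}
    (h : ∀ s ∈ Finset.range (n + 1),
      quaternaryTypeSum 20 18 7 5 m (fun x => x * 4 ^ n - 2 ^ s * 50 ^ m) ≤
        50 ^ m * binaryTypeSum 2 1 2 n fun y => y - 2 ^ s) :
    Majorizes (wordProd targetCoeff n) (wordProd sourceCoeff m) := by
  have hs : wordProd sourceCoeff m = fun x => ((wordProd sourceNum m x : ℕ) : ℝ) / (50 ^ m : ℕ) :=
    funext fun x => wordProd_div sourceNum 50 m x
  have ht : wordProd targetCoeff n = fun x => ((wordProd targetNum n x : ℕ) : ℝ) / (4 ^ n : ℕ) :=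
    funext fun x => wordProd_div targetNum 4 n x
  rw [hs, ht]
  refine majorizes_div_of_nat (by positivity) (by positivity) (sum_wordProd_sourceNum m)
    (sum_wordProd_targetNum n) fun l => ?_
  obtain ⟨s, hsr, hl⟩ := exists_wordProd_targetNum n l
  rw [hl]
  refine le_of_eq_of_le ?_ ((h s hsr).trans_eq ?_)
  · exact sum_quaternary 20 18 7 5 m fun x => x * 4 ^ n - 2 ^ s * 50 ^ m
  · exact congrArg _ (sum_ternary 2 1 n fun y => y - 2 ^ s).symm

/-- Majorization fails if the test at a single threshold `2 ^ s / 4 ^ n` fails. -/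
lemma not_majorizes_copies {m n : ℕ} (s : ℕ)
    (h : 50 ^ m * (binaryTypeSum 2 1 2 n fun y => y - 2 ^ s) <
      quaternaryTypeSum 20 18 7 5 m fun x => x * 4 ^ n - 2 ^ s * 50 ^ m) :
    ¬ Majorizes (wordProd targetCoeff n) (wordProd sourceCoeff m) := by
  intro hmaj
  have hs : wordProd sourceCoeff m = fun x => ((wordProd sourceNum m x : ℕ) : ℝ) / (50 ^ m : ℕ) :=
    funext fun x => wordProd_div sourceNum 50 m x
  have ht : wordProd targetCoeff n = fun x => ((wordProd targetNum n x : ℕ) : ℝ) / (4 ^ n : ℕ) :=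
    funext fun x => wordProd_div targetNum 4 n x
  rw [hs, ht] at hmaj
  have key := hmaj.nat_le (by positivity) (by positivity) (2 ^ s)
  refine absurd (le_of_eq_of_le ?_ (key.trans_eq ?_)) (not_le.2 h)
  · exact (sum_quaternary 20 18 7 5 m fun x => x * 4 ^ n - 2 ^ s * 50 ^ m).symm
  · exact congrArg _ (sum_ternary 2 1 n fun y => y - 2 ^ s)

lemma majorizes_copies_two : Majorizes (wordProd targetCoeff 2) (wordProd sourceCoeff 2) :=
  majorizes_copies (by decide +kernel)

lemma majorizes_copies_three : Majorizes (wordProd targetCoeff 3) (wordProd sourceCoeff 3) :=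
  majorizes_copies (by decide +kernel)

lemma majorizes_copies_eight_nine :
    Majorizes (wordProd targetCoeff 9) (wordProd sourceCoeff 8) :=
  majorizes_copies (by decide +kernel)

lemma majorizes_copies_of_two_le (k : ℕ) (hk : 2 ≤ k) :
    Majorizes (wordProd targetCoeff k) (wordProd sourceCoeff k) := by
  induction k using Nat.strong_induction_on with
  | _ k ih =>
    rcases Nat.lt_or_ge k 4 with h | h
    · interval_cases k
      exacts [majorizes_copies_two, majorizes_copies_three]
    · obtain ⟨l, rfl⟩ := Nat.exists_eq_add_of_le' hk
      exact (ih l (by omega) (by omega)).wordProd_add majorizes_copies_two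
        (fun j => (targetCoeff_pos j).le) fun i => (sourceCoeff_pos i).le

/-- With `k` copies of the catalyst state the Schmidt coefficients on the target side are the numbers
`2 ^ s * 3 ^ u * 2 ^ (k - u) / (4 ^ n * 5 ^ k)`, which are the thresholds to be tested. -/
lemma majorizes_copies_with_catalyst {m n k : ℕ}
    (h : ∀ s ∈ Finset.range (n + 1), ∀ u ∈ Finset.range (k + 1),
      (quaternaryTypeSum 20 18 7 5 m fun x => binaryTypeSum 3 2 1 k fun z =>
        x * z * (4 ^ n * 5 ^ k) - 2 ^ s * (3 ^ u * 2 ^ (k - u)) * (50 ^ m * 5 ^ k)) ≤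
      50 ^ m * 5 ^ k * binaryTypeSum 2 1 2 n fun y => binaryTypeSum 3 2 1 k fun z =>
        y * z - 2 ^ s * (3 ^ u * 2 ^ (k - u))) :
    Majorizes (fun p : (Fin n → Fin 3) × (Fin k → Fin 2) =>
        wordProd targetCoeff n p.1 * wordProd catalystCoeff k p.2)
      (fun p : (Fin m → Fin 4) × (Fin k → Fin 2) =>
        wordProd sourceCoeff m p.1 * wordProd catalystCoeff k p.2) := by
  have hs : (fun p : (Fin m → Fin 4) × (Fin k → Fin 2) =>
      wordProd sourceCoeff m p.1 * wordProd catalystCoeff k p.2) = fun p =>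
      ((wordProd sourceNum m p.1 * wordProd catalystNum k p.2 : ℕ) : ℝ) /
        (50 ^ m * 5 ^ k : ℕ) := by
    funext p
    rw [Nat.cast_mul, Nat.cast_mul, mul_div_mul_comm]
    exact congrArg₂ _ (wordProd_div sourceNum 50 m p.1) (wordProd_div catalystNum 5 k p.2)
  have ht : (fun p : (Fin n → Fin 3) × (Fin k → Fin 2) =>
      wordProd targetCoeff n p.1 * wordProd catalystCoeff k p.2) = fun p =>
      ((wordProd targetNum n p.1 * wordProd catalystNum k p.2 : ℕ) : ℝ) /
        (4 ^ n * 5 ^ k : ℕ) := by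
    funext p
    rw [Nat.cast_mul, Nat.cast_mul, mul_div_mul_comm]
    exact congrArg₂ _ (wordProd_div targetNum 4 n p.1) (wordProd_div catalystNum 5 k p.2)
  rw [hs, ht]
  refine majorizes_div_of_nat (by positivity) (by positivity) ?_ ?_ fun l => ?_
  · rw [Fintype.sum_prod_type, ← Fintype.sum_mul_sum, sum_wordProd_sourceNum,
      sum_wordProd_catalystNum]
  · rw [Fintype.sum_prod_type, ← Fintype.sum_mul_sum, sum_wordProd_targetNum,
      sum_wordProd_catalystNum]
  obtain ⟨s, hsr, hl⟩ := exists_wordProd_targetNum n l.1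
  obtain ⟨u, hur, hl'⟩ := exists_wordProd_catalystNum k l.2
  rw [hl, hl', Fintype.sum_prod_type, Fintype.sum_prod_type]
  have hcat : ∀ h : ℕ → ℕ, ∑ z, h (wordProd catalystNum k z) = binaryTypeSum 3 2 1 k h :=
    sum_binary 3 2 k
  have hsource : ∀ x, ∑ z, (x * wordProd catalystNum k z * (4 ^ n * 5 ^ k) -
      2 ^ s * (3 ^ u * 2 ^ (k - u)) * (50 ^ m * 5 ^ k)) = binaryTypeSum 3 2 1 k fun z =>
        x * z * (4 ^ n * 5 ^ k) - 2 ^ s * (3 ^ u * 2 ^ (k - u)) * (50 ^ m * 5 ^ k) :=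
    fun x => hcat fun z =>
      x * z * (4 ^ n * 5 ^ k) - 2 ^ s * (3 ^ u * 2 ^ (k - u)) * (50 ^ m * 5 ^ k)
  have htarget : ∀ y, ∑ z, (y * wordProd catalystNum k z - 2 ^ s * (3 ^ u * 2 ^ (k - u))) =
      binaryTypeSum 3 2 1 k fun z => y * z - 2 ^ s * (3 ^ u * 2 ^ (k - u)) :=
    fun y => hcat fun z => y * z - 2 ^ s * (3 ^ u * 2 ^ (k - u))
  simp only [hsource, htarget]
  refine le_of_eq_of_le ?_ ((h s hsr u hur).trans_eq ?_)
  · exact sum_quaternary 20 18 7 5 m fun x => binaryTypeSum 3 2 1 k fun z =>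
      x * z * (4 ^ n * 5 ^ k) - 2 ^ s * (3 ^ u * 2 ^ (k - u)) * (50 ^ m * 5 ^ k)
  · exact congrArg _ (sum_ternary 2 1 n fun y => binaryTypeSum 3 2 1 k fun z =>
      y * z - 2 ^ s * (3 ^ u * 2 ^ (k - u))).symm

lemma majorizes_seven_eight_with_catalyst :
    Majorizes (fun p : (Fin 8 → Fin 3) × (Fin 4 → Fin 2) =>
        wordProd targetCoeff 8 p.1 * wordProd catalystCoeff 4 p.2)
      (fun p : (Fin 7 → Fin 4) × (Fin 4 → Fin 2) =>
        wordProd sourceCoeff 7 p.1 * wordProd catalystCoeff 4 p.2) :=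
  majorizes_copies_with_catalyst (by decide +kernel)

lemma catalystCoeff_majorizes_sourceCoeff : Majorizes catalystCoeff sourceCoeff := by
  refine majorizes_of_forall_entry (fun i => (sourceCoeff_pos i).le)
    (fun j => (catalystCoeff_pos j).le) (by rw [sum_sourceCoeff, sum_catalystCoeff]) fun l => ?_
  fin_cases l <;>
    norm_num [Fin.sum_univ_succ, sourceCoeff, sourceNum, catalystCoeff, catalystNum]

/-- Four copies of the source state pay for the catalyst, which then serves `N + 1` conversions of
seven copies into eight and is discarded at the end. -/
lemma majorizes_copies_via_catalyst (N : ℕ) :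
    Majorizes (wordProd targetCoeff (8 * (N + 1))) (wordProd sourceCoeff (7 * (N + 1) + 4)) := by
  have hs : ∀ i, 0 ≤ sourceCoeff i := fun i => (sourceCoeff_pos i).le
  have ht : ∀ j, 0 ≤ targetCoeff j := fun j => (targetCoeff_pos j).le
  have hc : ∀ k, 0 ≤ catalystCoeff k := fun k => (catalystCoeff_pos k).le
  have hreuse : Majorizes (fun p : (Fin (8 * (N + 1)) → Fin 3) × (Fin 4 → Fin 2) =>
        wordProd targetCoeff (8 * (N + 1)) p.1 * wordProd catalystCoeff 4 p.2)
      (fun p : (Fin (7 * (N + 1)) → Fin 4) × (Fin 4 → Fin 2) =>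
        wordProd sourceCoeff (7 * (N + 1)) p.1 * wordProd catalystCoeff 4 p.2) := by
    induction N with
    | zero => exact majorizes_seven_eight_with_catalyst
    | succ N ih => exact ih.wordProd_add_catalyst majorizes_seven_eight_with_catalyst ht hs
  have hpay : Majorizes (wordProd catalystCoeff 4) (wordProd sourceCoeff 4) := by
    have h1 := catalystCoeff_majorizes_sourceCoeff.wordProd_one
    have h2 := h1.wordProd_add h1 hc hs
    exact h2.wordProd_add h2 hc hs
  have hbuy : Majorizes (fun p : (Fin (7 * (N + 1)) → Fin 4) × (Fin 4 → Fin 2) =>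
      wordProd sourceCoeff (7 * (N + 1)) p.1 * wordProd catalystCoeff 4 p.2)
      (wordProd sourceCoeff (7 * (N + 1) + 4)) := by
    intro t h0
    rw [sum_wordProd_add sourceCoeff (7 * (N + 1)) 4 fun y => max (y - t) 0]
    exact (Majorizes.refl _).tensor hpay (wordProd_nonneg hs _) (wordProd_nonneg hs _) t h0
  exact (majorizes_mul_of_sum_eq_one _ (wordProd_nonneg hc 4)
    (sum_wordProd_eq_one sum_catalystCoeff 4)).trans (hreuse.trans hbuy)

end Example

/-! ### Conversions, rates and entropies of the concrete states -/

namespace PureState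

lemma convertsTo_copies_of_majorizes {m n : ℕ} (hcard : 3 ^ n ≤ 4 ^ m)
    (h : Majorizes (wordProd targetCoeff n) (wordProd sourceCoeff m)) :
    (sourceState.tpow m).ConvertsTo (targetState.tpow n) := by
  rw [sourceState_eq, targetState_eq, tpow_ofSchmidt, tpow_ofSchmidt]
  exact convertsTo_of_majorizes (wordProd_pos sourceCoeff_pos m) (by simpa using hcard) h

lemma majorizes_of_convertsTo_copies {m n : ℕ}
    (h : (sourceState.tpow m).ConvertsTo (targetState.tpow n)) :
    Majorizes (wordProd targetCoeff n) (wordProd sourceCoeff m) := by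
  rw [sourceState_eq, targetState_eq, tpow_ofSchmidt, tpow_ofSchmidt] at h
  exact h.majorizes

/-- Comparing the largest Schmidt coefficients, `m` copies of the source state yield at most `2 * m`
copies of the target state. -/
lemma le_two_mul_of_convertsTo_copies {m n : ℕ}
    (h : (sourceState.tpow m).ConvertsTo (targetState.tpow n)) : n ≤ 2 * m := by
  have ht : ∀ j, targetCoeff j ≤ 1 / 2 := fun j => by
    fin_cases j <;> norm_num [targetCoeff, targetNum]
  have h1 := (majorizes_of_convertsTo_copies h).le_of_forall_le (t := (1 / 2) ^ n) (by positivity)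
    (wordProd_le_pow (fun j => (targetCoeff_pos j).le) ht n) (fun _ => 0)
  have h2 : wordProd sourceCoeff m (fun _ => 0) = (2 / 5) ^ m := by
    simp only [wordProd, Finset.prod_const, Finset.card_univ, Fintype.card_fin]
    norm_num [sourceCoeff, sourceNum]
  rw [h2] at h1
  by_contra hlt
  have h3 : ((1 : ℝ) / 2) ^ n ≤ (1 / 2) ^ (2 * m + 1) :=
    pow_le_pow_of_le_one (by norm_num) (by norm_num) (by omega)
  have h4 : ((1 : ℝ) / 4) ^ m ≤ (2 / 5) ^ m :=
    pow_le_pow_left₀ (by norm_num) (by norm_num) m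
  have h5 : (0 : ℝ) < (1 / 4) ^ m := by positivity
  rw [pow_succ, pow_mul] at h3
  rw [show ((1 : ℝ) / 2) ^ 2 = 1 / 4 by norm_num] at h3
  linarith

/-- A conversion of `m` copies into `n` copies bounds the exchange rate from below. -/
lemma div_le_exchangeRate {m n : ℕ} (hm : 0 < m) (hn : 0 < n)
    (h : (sourceState.tpow m).ConvertsTo (targetState.tpow n)) :
    (n / m : ℝ) ≤ sourceState.exchangeRate targetState := by
  have hbdd : ∀ m, BddAbove {n : ℕ | 0 < n ∧
      (sourceState.tpow m).ConvertsTo (targetState.tpow n)} := fun m =>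
    ⟨2 * m, fun n hn => le_two_mul_of_convertsTo_copies hn.2⟩
  have hle : n ≤ sourceState.maxCopies targetState m := le_csSup (hbdd m) ⟨hn, h⟩
  have hle2 : ∀ m, sourceState.maxCopies targetState m ≤ 2 * m := fun m =>
    csSup_le' fun n hn => le_two_mul_of_convertsTo_copies hn.2
  have hB : BddAbove (Set.range fun m : ℕ+ =>
      (sourceState.maxCopies targetState m : ℝ) / (m : ℝ)) := by
    refine ⟨2, ?_⟩
    rintro _ ⟨m, rfl⟩
    rw [div_le_iff₀ (by exact_mod_cast m.pos)]
    exact_mod_cast hle2 m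
  refine le_trans ?_ (le_ciSup hB ⟨m, hm⟩)
  simp only [PNat.mk_coe]
  gcongr

/-- The catalytic conversion of seven copies into eight reaches the rate `8 / 7` asymptotically. -/
lemma eight_div_seven_le_exchangeRate : 8 / 7 ≤ sourceState.exchangeRate targetState := by
  set D := sourceState.exchangeRate targetState
  have h : ∀ N : ℕ, 8 * ((N : ℝ) + 1) ≤ D * (7 * (N + 1) + 4) := by
    intro N
    have hcard : 3 ^ (8 * (N + 1)) ≤ 4 ^ (7 * (N + 1) + 4) :=
      calc 3 ^ (8 * (N + 1)) ≤ 4 ^ (7 * (N + 1)) := by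
            rw [pow_mul, pow_mul]
            exact Nat.pow_le_pow_left (by norm_num) _
        _ ≤ 4 ^ (7 * (N + 1) + 4) := Nat.pow_le_pow_right (by norm_num) (by omega)
    have h1 := div_le_exchangeRate (by omega) (by omega)
      (convertsTo_copies_of_majorizes hcard (majorizes_copies_via_catalyst N))
    rw [div_le_iff₀ (by positivity)] at h1
    push_cast at h1
    exact h1
  by_contra hlt
  push Not at hlt
  have hpos : 0 < 8 - 7 * D := by linarith
  obtain ⟨N, hN⟩ := exists_nat_gt (4 * D / (8 - 7 * D))
  rw [div_lt_iff₀ hpos] at hN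
  have := h N
  linarith

lemma not_convertsTo_target : ¬ sourceState.ConvertsTo targetState := by
  intro h
  rw [sourceState_eq, targetState_eq] at h
  -- At `t = 1 / 4` the two sides are `0.26` and `0.25`.
  have := h.majorizes (1 / 4) (by norm_num)
  norm_num [Fin.sum_univ_succ, sourceCoeff, sourceNum, targetCoeff, targetNum] at this

/-- The largest Schmidt coefficient cannot decrease, and `1 / 2 > 2 / 5`. -/
lemma not_convertsTo_source : ¬ targetState.ConvertsTo sourceState := by
  intro h
  rw [sourceState_eq, targetState_eq] at h
  have := h.majorizes.le_of_forall_le (t := 2 / 5) (by norm_num)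
    (fun i => by fin_cases i <;> norm_num [sourceCoeff, sourceNum]) 0
  norm_num [targetCoeff, targetNum] at this

lemma not_convertsTo_source_copies :
    ¬ (targetState.tpow 8).ConvertsTo (sourceState.tpow 7) := by
  intro h
  rw [sourceState_eq, targetState_eq, tpow_ofSchmidt, tpow_ofSchmidt] at h
  have hs : ∀ i, sourceCoeff i ≤ 2 / 5 := fun i => by
    fin_cases i <;> norm_num [sourceCoeff, sourceNum]
  have := h.majorizes.le_of_forall_le (t := (2 / 5) ^ 7) (by norm_num)
    (wordProd_le_pow (fun i => (sourceCoeff_pos i).le) hs 7) (fun _ => 0)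
  norm_num [wordProd, targetCoeff, targetNum] at this

lemma convertsTo_with_catalyst :
    ((sourceState.tpow 7).tensor (catalystState.tpow 4)).ConvertsTo
      ((targetState.tpow 8).tensor (catalystState.tpow 4)) := by
  rw [sourceState_eq, targetState_eq, catalystState_eq, tpow_ofSchmidt, tpow_ofSchmidt,
    tpow_ofSchmidt, tensor_ofSchmidt, tensor_ofSchmidt]
  exact convertsTo_of_majorizes
    (fun p => mul_pos (wordProd_pos sourceCoeff_pos _ _) (wordProd_pos catalystCoeff_pos _ _))
    (by simp) majorizes_seven_eight_with_catalyst

lemma renyiEntropy_two_source : renyiEntropy 2 sourceState = - Real.logb 2 (399 / 1250) := by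
  rw [sourceState, renyiEntropy_two_ofSchmidt]
  norm_num [Fin.sum_univ_succ]

lemma renyiEntropy_two_target : renyiEntropy 2 targetState = - Real.logb 2 (3 / 8) := by
  rw [targetState, renyiEntropy_two_ofSchmidt]
  norm_num [Fin.sum_univ_succ]

/-- The ratio of the entropies is `log 0.3192 / log 0.375`, which is enclosed by comparing integer
powers of the two arguments. -/
lemma renyiEntropy_two_div_bounds :
    (241 / 207 : ℝ) ≤ renyiEntropy 2 sourceState / renyiEntropy 2 targetState ∧
      renyiEntropy 2 sourceState / renyiEntropy 2 targetState ≤ 163 / 140 := by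
  have hlog : Real.log (3 / 8) < 0 := Real.log_neg (by norm_num) (by norm_num)
  have hratio : renyiEntropy 2 sourceState / renyiEntropy 2 targetState =
      -Real.log (399 / 1250) / -Real.log (3 / 8) := by
    rw [renyiEntropy_two_source, renyiEntropy_two_target, Real.logb, Real.logb, neg_div_neg_eq,
      neg_div_neg_eq, div_div_div_cancel_right₀ (Real.log_pos one_lt_two).ne']
  have h1 : 207 * Real.log (399 / 1250) ≤ 241 * Real.log (3 / 8) := by
    have := Real.log_le_log (x := (399 / 1250) ^ 207) (y := (3 / 8) ^ 241) (by positivity)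
      (by norm_num)
    simpa only [Real.log_pow, Nat.cast_ofNat] using this
  have h2 : 163 * Real.log (3 / 8) ≤ 140 * Real.log (399 / 1250) := by
    have := Real.log_le_log (x := (3 / 8) ^ 163) (y := (399 / 1250) ^ 140) (by positivity)
      (by norm_num)
    simpa only [Real.log_pow, Nat.cast_ofNat] using this
  rw [hratio, le_div_iff₀ (by linarith), div_le_iff₀ (by linarith)]
  constructor <;> linarith

end PureState

theorem mainTheorem5 :
    PureState.sourceState.Incomparable PureState.targetState ∧
    (∀ k : ℕ, 2 ≤ k →
      (PureState.sourceState.tpow k).ConvertsTo (PureState.targetState.tpow k)) ∧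
    (PureState.sourceState.tpow 8).ConvertsTo (PureState.targetState.tpow 9) ∧
    9 / 8 ≤ PureState.sourceState.exchangeRate PureState.targetState ∧
    (PureState.sourceState.tpow 7).Incomparable (PureState.targetState.tpow 8) ∧
    ((PureState.sourceState.tpow 7).tensor (PureState.catalystState.tpow 4)).ConvertsTo
      ((PureState.targetState.tpow 8).tensor (PureState.catalystState.tpow 4)) ∧
    8 / 7 ≤ PureState.sourceState.exchangeRate PureState.targetState ∧
    1 < PureState.sourceState.exchangeRate PureState.targetState ∧
    PureState.sourceState.entropyRatio PureState.targetState ≤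
      PureState.renyiEntropy 2 PureState.sourceState /
        PureState.renyiEntropy 2 PureState.targetState ∧
    |PureState.renyiEntropy 2 PureState.sourceState /
        PureState.renyiEntropy 2 PureState.targetState - 1.1643| < 0.00005 ∧
    PureState.sourceState.entropyRatio PureState.targetState ≤ 1.1643 ∧
    (1.1643 : ℝ) < 7 / 6 ∧
    ¬ (PureState.sourceState.tpow 6).ConvertsTo (PureState.targetState.tpow 7) := by
  have h98 := PureState.convertsTo_copies_of_majorizes (by norm_num) majorizes_copies_eight_nine
  have h2 : ∀ k : ℕ, 2 ≤ k →
      (PureState.sourceState.tpow k).ConvertsTo (PureState.targetState.tpow k) := fun k hk =>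
    PureState.convertsTo_copies_of_majorizes (Nat.pow_le_pow_left (by norm_num) k)
      (majorizes_copies_of_two_le k hk)
  have hD : (9 / 8 : ℝ) ≤ PureState.sourceState.exchangeRate PureState.targetState := by
    have := PureState.div_le_exchangeRate (by norm_num) (by norm_num) h98
    norm_num at this
    exact this
  obtain ⟨hlo, hhi⟩ := PureState.renyiEntropy_two_div_bounds
  have hR : PureState.sourceState.entropyRatio PureState.targetState ≤
      PureState.renyiEntropy 2 PureState.sourceState /
        PureState.renyiEntropy 2 PureState.targetState :=
    PureState.entropyRatio_le _ _ (PureState.sum_schmidtCoeff_ofSchmidt _ _ _)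
      (PureState.sum_schmidtCoeff_ofSchmidt _ _ _) 2
  refine ⟨⟨PureState.not_convertsTo_target, PureState.not_convertsTo_source⟩, h2, h98, hD,
    ⟨fun h => ?_, PureState.not_convertsTo_source_copies⟩, PureState.convertsTo_with_catalyst,
    ?_, ?_, hR, ?_, ?_, by norm_num, fun h => ?_⟩
  -- Majorization fails at the threshold `2 ^ 5 / 4 ^ 8`.
  · exact not_majorizes_copies 5 (by decide +kernel) (PureState.majorizes_of_convertsTo_copies h)
  · exact PureState.eight_div_seven_le_exchangeRate
  · linarith
  · rw [abs_lt]
    constructor <;> norm_num at hlo hhi ⊢ <;> linarith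
  · norm_num at hhi ⊢
    linarith
  -- Majorization fails at the threshold `2 ^ 3 / 4 ^ 7`.
  · exact not_majorizes_copies 3 (by decide +kernel) (PureState.majorizes_of_convertsTo_copies h)
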